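/- **Model.** Fix an integer $m\ge 0$ and real parameters $\alpha>\tfrac12$, $\beta\ge 0$, $\Delta>0$, $0<\delta<\tfrac{40}{81}$; put $g=e^{-\alpha\Delta}$ and assume $\beta<(1-\tfrac{81}{40}\delta)g^2\alpha$. Put $\eta=\delta^2g^2\alpha$ and $\mu=\dfrac{9e^{2\eta/27}}{(1-e^{-\eta/27})^2}$. On a probability space there are, for every $j\in\{0,\dots,m\}$, random $j$-blocks $0,1,2,\dots$, each either honest or adversarial; $j$-blocks with $j\ge1$ are voter blocks. Block $k$ is mined at time $T^j_k$ and published at time $P^j_k\in[T^j_k,\infty]$. The genesis block $0$ is honest and $T^j_0=0$; the other blocks are numbered in the order of their mining times, which are positive, and only finitely many are mined by any finite time. Every block $k\ge1$ has a parent $f^j(k)\in\{0,\dots,k-1\}$ mined strictly earlier. The $j$-blockchain $k$ is the path $(b_0,\dots,b_n)$ of $j$-blocks with $b_0=0$, $b_n=k$, $f^j(b_i)=b_{i-1}$; its height is $n$. It is published by time $t$ if all its blocks are. It is $t$-credible if it is published by time $t$ and no $j$-blockchain published by time $t-\Delta$ is higher. An honest block $k$ satisfies $P^j_k=T^j_k$,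 and if $k\ge 1$ its parent's blockchain is $T^j_k$-credible. The honest non-genesis $j$-blocks are mined according to a homogeneous Poisson process of rate $\alpha$, independently for different $j$. The number $Z^j_{s,t}$ of adversarial $j$-blocks mined during $(s,t]$ satisfies $P(Z^j_{s,t}\le n)\ge e^{-\beta(t-s)}\sum_{i=0}^n(\beta(t-s))^i/i!$ for all $0\le s<t$ and $n\in\{0,1,2,\dots\}$. Everything else (the adversarial strategy and the network) is arbitrary. An honest $j$-block mined at time $T$ is a $j$-lagger if it is the only honest $j$-block (the genesis block included) mined during $[T-\Delta,T]$; a $j$-lagger is a $j$-loner if it is also the only one mined during $[T,T+\Delta]$. Let $N^j_{s,t},X^j_{s,t},Y^j_{s,t}$ be the numbers of honest $j$-blocks, $j$-laggers and $j$-loners mined during $(s,t]$. For $0\le s<t$ let $E^j_{s,t}$ be the event that $$(1-\delta)(t-s)\alpha<N^j_{s,t}<(1+\delta)(t-s)\alpha,\quad X^j_{s,t}>(1-\delta)(t-s)g\alpha,$$ $$Y^j_{s,t}>(1-\delta)(t-s)g^2\alpha,\quad Z^j_{s,t}<(t-s)\beta+(t-s)g^2\alpha\delta,$$ and let $G^j_{s,t}=\bigcap_{a\in[0,s],\,b\in[t,\infty)}E^j_{a,b}$.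 The $k$-deep prefix of $(b_0,\dots,b_n)$ is $(b_0,\dots,b_{n-k})$. A sequence of $j$-blocks is permanent after time $t$ if, for every $r\ge t$, every $r$-credible $j$-blockchain extends it. **Theorem.** 1. (Growth) Let $j\in\{0,\dots,m\}$ and $0\le s<t-\frac{80\Delta}{\delta}$. On $E^j_{s+\Delta,t-\Delta}$, every $t$-credible $j$-blockchain is higher than every $s$-credible $j$-blockchain by at least $(1-\frac{41}{40}\delta)g\alpha(t-s)$. Consequently, the probability that some $t$-credible $j$-blockchain is less than $(1-\frac{41}{40}\delta)g\alpha(t-s)$ higher than some $s$-credible $j$-blockchain is at most $9e^{-\frac1{24}\eta(t-s)}$. 2. (Quality) Let $j\in\{0,\dots,m\}$, and let the integer $k$ and the real $t$ satisfy $k\ge\frac{160\alpha(1+\Delta)}{\delta}$ and $t\ge\frac{k}{(1-\frac{41}{40}\delta)g\alpha}$. On $G^j_{t-\frac{k}{2\alpha}+\Delta,\;t-\Delta}$, every $t$-credible $j$-blockchain has height at least $k$, and at least $(1-g)k$ of its last $k$ blocks are honest. Consequently, the probability that more than $gk$ of the last $k$ blocks of some $t$-credible $j$-blockchain are adversarial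 is at most $\mu e^{-\frac{\eta}{27}(\frac{k}{2\alpha}-2\Delta)}$. 3. (Common prefix) Let $j\in\{1,\dots,m\}$ and let $k,t$ be as in 2. On $G^j_{t-\frac{k}{2\alpha}+\Delta,\;t-\Delta}$, the $(k-1)$-deep prefix of every $t$-credible $j$-blockchain exists (the height is at least $k-1$) and is extended by every $r$-credible $j$-blockchain, for all $r\ge t$. Consequently, with probability at least $1-\mu e^{-\frac{\eta}{27}(\frac{k}{2\alpha}-2\Delta)}$, the $(k-1)$-deep prefix of every $t$-credible $j$-blockchain is permanent after time $t$. -/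

import Mathlib

open MeasureTheory ProbabilityTheory Filter
open scoped NNReal ENNReal

noncomputable section

namespace Prism

/-- One realization, from time `0` to eternity, of the blocks of a single category
(the `j`-blocks for one fixed `j`). Block `0` is the genesis block and the other blocks are
numbered `1, 2, …` in the order in which they are mined. -/
structure BlockTree where
  /-- the parent of a block (the value at the genesis block is irrelevant) -/
  parent : ℕ → ℕ
  /-- the time at which a block is mined -/
  mined : ℕ → ℝ
  /-- the time at which a block is published; the value `⊤` means that it is never published -/
  published : ℕ → EReal
  /-- the set of the honest blocks; all other blocks are adversarial -/
  honest : Set ℕ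
  parent_lt : ∀ k, 0 < k → parent k < k
  mined_zero : mined 0 = 0
  mined_pos : ∀ k, 0 < k → 0 < mined k
  mined_mono : Monotone mined
  /-- only finitely many blocks are mined by any given time -/
  mined_tendsto : Tendsto mined atTop atTop
  mined_parent_lt : ∀ k, 0 < k → mined (parent k) < mined k
  mined_le_published : ∀ k, (mined k : EReal) ≤ published k
  genesis_honest : 0 ∈ honest

namespace BlockTree

variable (c : BlockTree)

/-- Blockchain `k`: the sequence `(b₀, …, bₙ)` of blocks with `b₀ = 0`, `bₙ = k` and
`parent bᵢ = bᵢ₋₁`. -/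
def chain : ℕ → List ℕ
  | 0 => [0]
  | k + 1 => chain (c.parent (k + 1)) ++ [k + 1]
termination_by k => k
decreasing_by exact c.parent_lt (k + 1) (Nat.succ_pos k)

/-- The number of non-genesis blocks of blockchain `k`. -/
def height (k : ℕ) : ℕ := (c.chain k).length - 1

/-- Blockchain `b` is published by time `t`: all of its blocks are. -/
def PublishedBy (t : ℝ) (b : ℕ) : Prop := ∀ x ∈ c.chain b, c.published x ≤ (t : EReal)

/-- Blockchain `b` is `t`-credible, where `Δ` is the bound on the communication delays. -/
def Credible (Δ t : ℝ) (b : ℕ) : Prop :=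
  c.PublishedBy t b ∧ ∀ k, c.PublishedBy (t - Δ) k → c.height k ≤ c.height b

/-- Honest blocks are published as soon as they are mined, and every non-genesis honest block,
mined at time `T` say, extends a `T`-credible blockchain. -/
def FollowsProtocol (Δ : ℝ) : Prop :=
  ∀ k ∈ c.honest, c.published k = (c.mined k : EReal) ∧
    (0 < k → c.Credible Δ (c.mined k) (c.parent k))

/-- For a blockchain `(b₀, …, bₙ)` with last block `b = bₙ`, the `k`-deep prefix
`(b₀, …, bₙ₋ₖ)`. -/
def deepPrefix (k b : ℕ) : List ℕ := (c.chain b).rdrop k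

/-- The last `k` blocks of blockchain `b`. -/
def lastBlocks (k b : ℕ) : List ℕ := (c.chain b).rtake k

open Classical in
/-- The number of honest blocks among the last `k` blocks of blockchain `b`. -/
def honestAmongLast (k b : ℕ) : ℕ := (c.lastBlocks k b).countP (fun x => x ∈ c.honest)

open Classical in
/-- The number of adversarial blocks among the last `k` blocks of blockchain `b`. -/
def adversarialAmongLast (k b : ℕ) : ℕ := (c.lastBlocks k b).countP (fun x => x ∉ c.honest)

/-- A sequence of blocks is permanent after time `t` if every `r`-credible blockchain with
`r ≥ t` extends it. -/
def PermanentAfter (Δ t : ℝ) (l : List ℕ) : Prop :=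
  ∀ r, t ≤ r → ∀ b, c.Credible Δ r b → l <+: c.chain b

/-- Block `k` is a lagger: it is the only honest block mined during `[T - Δ, T]`, where `T` is
the time when it is mined. -/
def IsLagger (Δ : ℝ) (k : ℕ) : Prop :=
  k ∈ c.honest ∧
    ∀ l ∈ c.honest, c.mined l ∈ Set.Icc (c.mined k - Δ) (c.mined k) → l = k

/-- Block `k` is a loner: a lagger which is also the only honest block mined during
`[T, T + Δ]`. -/
def IsLoner (Δ : ℝ) (k : ℕ) : Prop :=
  c.IsLagger Δ k ∧
    ∀ l ∈ c.honest, c.mined l ∈ Set.Icc (c.mined k) (c.mined k + Δ) → l = k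

/-- The number of honest blocks mined during `(s, t]`. -/
def numHonest (s t : ℝ) : ℕ := {k | k ∈ c.honest ∧ c.mined k ∈ Set.Ioc s t}.ncard

/-- The number of laggers mined during `(s, t]`. -/
def numLagger (Δ s t : ℝ) : ℕ := {k | c.IsLagger Δ k ∧ c.mined k ∈ Set.Ioc s t}.ncard

/-- The number of loners mined during `(s, t]`. -/
def numLoner (Δ s t : ℝ) : ℕ := {k | c.IsLoner Δ k ∧ c.mined k ∈ Set.Ioc s t}.ncard

/-- The number of adversarial blocks mined during `(s, t]`. -/
def numAdversarial (s t : ℝ) : ℕ := {k | k ∉ c.honest ∧ c.mined k ∈ Set.Ioc s t}.ncard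

end BlockTree

/-- The propagation discount `g = e^{-αΔ}`. -/
def discount (α Δ : ℝ) : ℝ := Real.exp (-(α * Δ))

/-- `η = δ² g² α`. -/
def eta (α Δ δ : ℝ) : ℝ := δ ^ 2 * discount α Δ ^ 2 * α

/-- `μ = 9 e^{2η/27} / (1 - e^{-η/27})²`. -/
def mu (α Δ δ : ℝ) : ℝ :=
  9 * Real.exp (2 / 27 * eta α Δ δ) / (1 - Real.exp (-(1 / 27 * eta α Δ δ))) ^ 2

/-- The outcome `c` lies in the `δ`-good event with respect to the time interval `(s, t]`. -/
def GoodEvent (α β Δ δ s t : ℝ) (c : BlockTree) : Prop :=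
  ((1 - δ) * (t - s) * α < c.numHonest s t ∧ (c.numHonest s t : ℝ) < (1 + δ) * (t - s) * α) ∧
  (1 - δ) * (t - s) * discount α Δ * α < c.numLagger Δ s t ∧
  (1 - δ) * (t - s) * discount α Δ ^ 2 * α < c.numLoner Δ s t ∧
  (c.numAdversarial s t : ℝ) < (t - s) * β + (t - s) * discount α Δ ^ 2 * α * δ

/-- The outcome `c` lies in the `δ`-typical event with respect to the time interval `(s, t]`. -/
def TypicalEvent (α β Δ δ s t : ℝ) (c : BlockTree) : Prop :=
  ∀ a ∈ Set.Icc 0 s, ∀ b ∈ Set.Ici t, GoodEvent α β Δ δ a b c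

variable {Ω : Type*} [MeasurableSpace Ω]

/-- The counting process `(N t)` of a point process on `(0, ∞)` (so that `N` is nondecreasing) is
that of a homogeneous Poisson point process with rate `α`: the numbers of points in successive
intervals are independent, and the number of points in `(s, t]` is Poisson distributed with
parameter `α (t - s)`. -/
structure IsPoissonCounting (N : ℝ≥0 → Ω → ℕ) (α : ℝ) (P : Measure Ω) : Prop where
  indep_increments : HasIndepIncrements N P
  law_increments : ∀ s t : ℝ≥0, s ≤ t →
    HasLaw (fun ω => N t ω - N s ω) (poissonMeasure (α.toNNReal * (t - s))) P

/-- The Prism backbone protocol with one proposer category `0` and `m` voter categories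
`1, …, m` of blocks, under an arbitrary adversarial strategy: a random block tree for every
category such that, in every category,
* every outcome obeys the rules that bind the honest miners, for the delay bound `Δ`;
* honest blocks are mined according to a Poisson process of rate `α`, independently of the honest
  blocks of the other categories;
* the number of adversarial blocks mined during `(s, t]` is stochastically dominated by a Poisson
  variable with parameter `β (t - s)`.
Parents, publication times and the choice of the adversarial blocks are otherwise arbitrary. -/
structure Model (P : Measure Ω) (m : ℕ) (α β Δ : ℝ) where
  /-- the blocks of category `j` -/
  tree : Fin (m + 1) → Ω → BlockTree
  follows : ∀ j ω, (tree j ω).FollowsProtocol Δ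
  measurable_mined : ∀ j k, Measurable fun ω => (tree j ω).mined k
  measurable_honest : ∀ j k, MeasurableSet {ω | k ∈ (tree j ω).honest}
  honest_poisson : ∀ j, IsPoissonCounting (fun t ω => (tree j ω).numHonest 0 t) α P
  honest_indep : iIndepFun (fun j ω (t : ℝ≥0) => (tree j ω).numHonest 0 t) P
  adversarial_le : ∀ j, ∀ s t : ℝ, 0 ≤ s → s < t → ∀ n : ℕ,
    Real.exp (-(β * (t - s))) * ∑ i ∈ Finset.range (n + 1), (β * (t - s)) ^ i / (i.factorial : ℝ)
      ≤ P.real {ω | (tree j ω).numAdversarial s t ≤ n}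

end Prism

end

noncomputable section

namespace Prism

/-! ### Blockchains as root paths of a tree: prefixes and heights. -/

namespace BlockTree

variable (c : BlockTree)

/-! An honest block mined at least `Δ` after a blockchain was published is strictly higher than it.
Hence laggers have pairwise distinct heights, and no other honest block has the height of a loner.
The three properties follow from this on good or typical outcomes. Growth
(`height_add_numLagger_le`): the laggers mined in `(s + Δ, t - Δ]` have distinct heights above every
`s`-credible blockchain and not above any `t`-credible one. Quality: follow a credible blockchain
back from depth `k` to its last honest block, mined at time `T`. By growth the segment after that
block has length at least about `gα(t - T)`, whereas fewer adversarial blocks than `g` times this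
bound are mined in `(T, t]`. The blocks of the segment outside the last `k` are all adversarial,
which only helps. Common prefix (`prefix_step`): if credible blockchains of nearby times disagree on
a deep block, every loner mined after their last relevant common honest block has a height at which
one of the two carries an adversarial block. This injects loners into adversarial blocks, although
typically there are more loners. Steps of at most one time unit then reach all later times. Both of
the last two arguments need long windows. `TypicalEvent.mined_le` supplies them: `k` consecutive
blocks take time at least `k / (2α)`. For the probabilities, honest and adversarial counts obey
Poisson Chernoff bounds. Laggers and loners are dependent, so time is cut into cells of width `Δ /
K`, and isolated cells, which must contain a lagger or a loner, are counted through one indicator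
per group of `K` cells. Such an indicator depends on three adjacent groups only, so those in one
residue class mod 3 are independent; Chernoff in each class and `K → ∞` give the tails. Rounding
endpoints to integers and summing a double geometric series controls all windows of a typical event
at once. -/

theorem chain_zero : c.chain 0 = [0] := by rw [chain]

theorem chain_of_pos {k : ℕ} (hk : 0 < k) : c.chain k = c.chain (c.parent k) ++ [k] := by
  obtain ⟨k, rfl⟩ := Nat.exists_eq_succ_of_ne_zero hk.ne'
  rw [chain]

theorem exists_chain_eq_append (k : ℕ) : ∃ l, c.chain k = l ++ [k] := by
  rcases Nat.eq_zero_or_pos k with rfl | hk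
  · exact ⟨[], c.chain_zero⟩
  · exact ⟨_, c.chain_of_pos hk⟩

theorem length_chain (k : ℕ) : (c.chain k).length = c.height k + 1 := by
  obtain ⟨l, hl⟩ := c.exists_chain_eq_append k
  rw [height, hl, List.length_append, List.length_singleton, Nat.add_sub_cancel]

theorem height_zero : c.height 0 = 0 := by simp [height, chain_zero]

theorem height_of_pos {k : ℕ} (hk : 0 < k) : c.height k = c.height (c.parent k) + 1 := by
  have h1 := c.length_chain k
  rw [c.chain_of_pos hk, List.length_append, List.length_singleton, c.length_chain] at h1
  omega

theorem mem_chain_self (k : ℕ) : k ∈ c.chain k := by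
  obtain ⟨l, hl⟩ := c.exists_chain_eq_append k
  simp [hl]

theorem chain_injective : Function.Injective c.chain := by
  intro x y h
  obtain ⟨l, hl⟩ := c.exists_chain_eq_append x
  obtain ⟨l', hl'⟩ := c.exists_chain_eq_append y
  rw [hl, hl'] at h
  simpa using (List.append_inj' h rfl).2

theorem zero_mem_chain (k : ℕ) : 0 ∈ c.chain k := by
  induction k using Nat.strong_induction_on with
  | _ k ih =>
    rcases Nat.eq_zero_or_pos k with rfl | hk
    · exact c.mem_chain_self 0
    · rw [c.chain_of_pos hk]
      exact List.mem_append_left _ (ih _ (c.parent_lt k hk))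

theorem chain_prefix_of_mem {x b : ℕ} (h : x ∈ c.chain b) : c.chain x <+: c.chain b := by
  induction b using Nat.strong_induction_on with
  | _ b ih =>
    rcases Nat.eq_zero_or_pos b with rfl | hb
    · rw [chain_zero, List.mem_singleton] at h
      rw [h]
    · rw [c.chain_of_pos hb, List.mem_append, List.mem_singleton] at h
      rcases h with h | rfl
      · rw [c.chain_of_pos hb]
        exact (ih _ (c.parent_lt b hb) h).trans (List.prefix_append _ _)
      · exact List.prefix_rfl

theorem mem_chain_trans {x y z : ℕ} (h : x ∈ c.chain y) (h' : y ∈ c.chain z) : x ∈ c.chain z :=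
  (c.chain_prefix_of_mem h').subset h

theorem mem_chain_of_prefix {x b : ℕ} (h : c.chain x <+: c.chain b) : x ∈ c.chain b :=
  h.subset (c.mem_chain_self x)

theorem height_le_of_mem {x b : ℕ} (h : x ∈ c.chain b) : c.height x ≤ c.height b := by
  have := (c.chain_prefix_of_mem h).length_le
  rw [length_chain, length_chain] at this
  omega

theorem mem_chain_of_height_le {x y b : ℕ} (hx : x ∈ c.chain b) (hy : y ∈ c.chain b)
    (h : c.height x ≤ c.height y) : x ∈ c.chain y :=
  c.mem_chain_of_prefix <| List.prefix_of_prefix_length_le (c.chain_prefix_of_mem hx)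
    (c.chain_prefix_of_mem hy) (by rw [length_chain, length_chain]; omega)

theorem eq_of_mem_of_height_eq {x y b : ℕ} (hx : x ∈ c.chain b) (hy : y ∈ c.chain b)
    (h : c.height x = c.height y) : x = y := by
  have h1 := c.chain_prefix_of_mem (c.mem_chain_of_height_le hx hy h.le)
  exact c.chain_injective (h1.eq_of_length (by rw [length_chain, length_chain, h]))

theorem exists_mem_chain_height_eq {b h : ℕ} (hb : h ≤ c.height b) :
    ∃ y ∈ c.chain b, c.height y = h := by
  induction b using Nat.strong_induction_on with
  | _ b ih =>
    rcases hb.lt_or_eq with hlt | rfl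
    · have hpos : 0 < b := by
        rcases Nat.eq_zero_or_pos b with rfl | hb'
        · rw [height_zero] at hlt; omega
        · exact hb'
      rw [c.height_of_pos hpos] at hlt
      obtain ⟨y, hy, hyh⟩ := ih _ (c.parent_lt b hpos) (by omega)
      exact ⟨y, by rw [c.chain_of_pos hpos]; exact List.mem_append_left _ hy, hyh⟩
    · exact ⟨b, c.mem_chain_self b, rfl⟩

theorem mined_lt_of_mem {x b : ℕ} (h : x ∈ c.chain b) (hne : x ≠ b) : c.mined x < c.mined b := by
  induction b using Nat.strong_induction_on with
  | _ b ih =>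
    rcases Nat.eq_zero_or_pos b with rfl | hb
    · rw [chain_zero, List.mem_singleton] at h
      exact absurd h hne
    · rw [c.chain_of_pos hb, List.mem_append, List.mem_singleton] at h
      have hp := c.mined_parent_lt b hb
      rcases h with h | h
      · by_cases hxp : x = c.parent b
        · rwa [hxp]
        · exact (ih _ (c.parent_lt b hb) h hxp).trans hp
      · exact absurd h hne

theorem mined_lt_of_mem_of_height_lt {x y b : ℕ} (hx : x ∈ c.chain b) (hy : y ∈ c.chain b)
    (h : c.height x < c.height y) : c.mined x < c.mined y :=
  c.mined_lt_of_mem (c.mem_chain_of_height_le hx hy h.le) (by rintro rfl; exact h.false)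

theorem nodup_chain (b : ℕ) : (c.chain b).Nodup := by
  induction b using Nat.strong_induction_on with
  | _ b ih =>
    rcases Nat.eq_zero_or_pos b with rfl | hb
    · simp [chain_zero]
    · rw [c.chain_of_pos hb]
      refine (ih _ (c.parent_lt b hb)).append (List.nodup_singleton b) ?_
      intro x hx hxb
      rw [List.mem_singleton] at hxb
      subst hxb
      have := c.height_le_of_mem hx
      rw [c.height_of_pos hb] at this
      omega

/-- A nonempty prefix of a blockchain is a blockchain. -/
theorem exists_chain_eq_rdrop {b k : ℕ} (hk : k ≤ c.height b) :
    ∃ y ∈ c.chain b, c.height y = c.height b - k ∧ (c.chain b).rdrop k = c.chain y := by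
  obtain ⟨y, hy, hyh⟩ := c.exists_mem_chain_height_eq (b := b) (h := c.height b - k) (by omega)
  refine ⟨y, hy, hyh, ?_⟩
  refine (List.prefix_of_prefix_length_le (List.take_prefix _ _)
    (c.chain_prefix_of_mem hy) ?_).eq_of_length ?_ <;>
  · simp [length_chain]
    omega

/-- Every blockchain decomposes into the blockchain of its last honest block and adversarial
blocks. -/
theorem exists_last_honest (y : ℕ) :
    ∃ x ∈ c.honest, ∃ l, c.chain y = c.chain x ++ l ∧ ∀ z ∈ l, z ∉ c.honest := by
  induction y using Nat.strong_induction_on with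
  | _ y ih =>
    by_cases hy : y ∈ c.honest
    · exact ⟨y, hy, [], by simp⟩
    · have hpos : 0 < y := Nat.pos_of_ne_zero (by rintro rfl; exact hy c.genesis_honest)
      obtain ⟨x, hx, l, hl, hlz⟩ := ih _ (c.parent_lt y hpos)
      refine ⟨x, hx, l ++ [y], by rw [c.chain_of_pos hpos, hl, List.append_assoc], ?_⟩
      intro z hz
      rw [List.mem_append, List.mem_singleton] at hz
      rcases hz with hz | rfl
      · exact hlz z hz
      · exact hy

theorem mined_nonneg (k : ℕ) : 0 ≤ c.mined k := by
  rw [← c.mined_zero]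
  exact c.mined_mono (Nat.zero_le k)

theorem pos_of_mined_pos {k : ℕ} (h : 0 < c.mined k) : 0 < k :=
  Nat.pos_of_ne_zero (by rintro rfl; rw [c.mined_zero] at h; exact h.false)

theorem finite_mined_le (t : ℝ) : {k | c.mined k ≤ t}.Finite := by
  obtain ⟨n, hn⟩ := (c.mined_tendsto.eventually_gt_atTop t).exists
  refine (Set.finite_Iio n).subset fun k hk => ?_
  by_contra hnk
  exact absurd (c.mined_mono (not_lt.mp hnk)) (not_le.mpr (lt_of_le_of_lt hk hn))

theorem finite_mined_mem_Ioc (p : ℕ → Prop) (s t : ℝ) :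
    {k | p k ∧ c.mined k ∈ Set.Ioc s t}.Finite :=
  (c.finite_mined_le t).subset fun _ hk => hk.2.2

/-! ### Publication, credibility and the heights of honest blocks. -/

variable {c}

theorem PublishedBy.mono {s t : ℝ} {b : ℕ} (h : c.PublishedBy s b) (hst : s ≤ t) :
    c.PublishedBy t b :=
  fun x hx => (h x hx).trans (by exact_mod_cast hst)

theorem PublishedBy.mined_le {t : ℝ} {b x : ℕ} (h : c.PublishedBy t b) (hx : x ∈ c.chain b) :
    c.mined x ≤ t := by
  exact_mod_cast (c.mined_le_published x).trans (h x hx)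

theorem publishedBy_zero {Δ t : ℝ} (hc : c.FollowsProtocol Δ) (ht : 0 ≤ t) :
    c.PublishedBy t 0 := by
  intro x hx
  rw [chain_zero, List.mem_singleton] at hx
  subst hx
  rw [(hc 0 c.genesis_honest).1, c.mined_zero]
  exact_mod_cast ht

theorem publishedBy_mined {Δ : ℝ} (hc : c.FollowsProtocol Δ) {k : ℕ} (hk : k ∈ c.honest) :
    c.PublishedBy (c.mined k) k := by
  rcases Nat.eq_zero_or_pos k with rfl | hpos
  · exact publishedBy_zero hc c.mined_zero.ge
  · intro x hx
    rw [c.chain_of_pos hpos, List.mem_append, List.mem_singleton] at hx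
    rcases hx with hx | rfl
    · exact ((hc k hk).2 hpos).1 x hx
    · exact (hc x hk).1.le

theorem credible_zero {Δ : ℝ} (hΔ : 0 < Δ) (hc : c.FollowsProtocol Δ) : c.Credible Δ 0 0 := by
  refine ⟨publishedBy_zero hc le_rfl, fun k hk => ?_⟩
  have := hk.mined_le (c.mem_chain_self k)
  have := c.mined_nonneg k
  linarith

/-- A highest one among the finitely many blockchains published by `t` will do. This supplies the
intermediate blockchains of the common prefix induction. -/
theorem exists_credible {Δ t : ℝ} (hΔ : 0 < Δ) (hc : c.FollowsProtocol Δ) (ht : 0 ≤ t) :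
    ∃ b, c.Credible Δ t b := by
  have hfin : {b | c.PublishedBy t b}.Finite :=
    (c.finite_mined_le t).subset fun b hb => hb.mined_le (c.mem_chain_self b)
  obtain ⟨b, hb, hmax⟩ := hfin.exists_maximalFor c.height _ ⟨0, publishedBy_zero hc ht⟩
  refine ⟨b, hb, fun k hk => ?_⟩
  by_contra hlt
  exact hlt (hmax (hk.mono (by linarith)) (not_le.mp hlt).le)

/-- The parent of `l` is credible when `l` is mined, and `e` was already published `Δ` earlier. This
is the only way in which honest behaviour forces heights up. -/
theorem height_lt_of_publishedBy {Δ s : ℝ} (hc : c.FollowsProtocol Δ) {e l : ℕ}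
    (he : c.PublishedBy s e) (hl : l ∈ c.honest) (hpos : 0 < l) (hs : s + Δ ≤ c.mined l) :
    c.height e < c.height l := by
  have := ((hc l hl).2 hpos).2 e (he.mono (by linarith))
  rw [c.height_of_pos hpos]
  omega

theorem height_lt_of_honest {Δ : ℝ} (hΔ : 0 < Δ) (hc : c.FollowsProtocol Δ) {l l' : ℕ}
    (hl : l ∈ c.honest) (hl' : l' ∈ c.honest) (h : c.mined l + Δ ≤ c.mined l') :
    c.height l < c.height l' :=
  height_lt_of_publishedBy hc (publishedBy_mined hc hl) hl'
    (c.pos_of_mined_pos (by have := c.mined_nonneg l; linarith)) h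

/-- A loner is the only honest block of its height. -/
theorem IsLoner.eq_of_height_eq {Δ : ℝ} (hΔ : 0 < Δ) (hc : c.FollowsProtocol Δ) {l l' : ℕ}
    (hl : c.IsLoner Δ l) (hl' : l' ∈ c.honest) (h : c.height l' = c.height l) : l' = l := by
  by_contra hne
  have h1 : ¬ c.mined l' ∈ Set.Icc (c.mined l - Δ) (c.mined l) := fun h' => hne (hl.1.2 l' hl' h')
  have h2 : ¬ c.mined l' ∈ Set.Icc (c.mined l) (c.mined l + Δ) := fun h' => hne (hl.2 l' hl' h')
  simp only [Set.mem_Icc, not_and_or, not_le] at h1 h2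
  -- Any other honest block is at least `Δ` away in time, so the later of the two is strictly
  -- higher.
  have h3 : c.mined l' + Δ ≤ c.mined l ∨ c.mined l + Δ ≤ c.mined l' := by
    rcases h1 with h1 | h1
    · left; linarith
    · right
      rcases h2 with h2 | h2 <;> linarith
  rcases h3 with h3 | h3
  · exact (height_lt_of_honest hΔ hc hl' hl.1.1 h3).ne h
  · exact (height_lt_of_honest hΔ hc hl.1.1 hl' h3).ne' h

theorem IsLagger.eq_of_height_eq {Δ : ℝ} (hΔ : 0 < Δ) (hc : c.FollowsProtocol Δ) {l l' : ℕ}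
    (hl : c.IsLagger Δ l) (hl' : c.IsLagger Δ l') (h : c.height l = c.height l') : l = l' := by
  wlog hle : c.mined l ≤ c.mined l' generalizing l l'
  · exact (this hl' hl h.symm (not_le.mp hle).le).symm
  by_contra hne
  have h1 : ¬ c.mined l ∈ Set.Icc (c.mined l' - Δ) (c.mined l') :=
    fun h' => hne (hl'.2 l hl.1 h')
  simp only [Set.mem_Icc, not_and_or, not_le] at h1
  rcases h1 with h1 | h1
  · exact (height_lt_of_honest hΔ hc hl.1 hl'.1 (by linarith)).ne h
  · exact absurd h1 (not_lt.mpr hle)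

/-- Every lagger raises the blockchains by at least one block. -/
theorem height_add_numLagger_le {Δ s t : ℝ} (hΔ : 0 < Δ) (hs : 0 ≤ s) (hst : s + Δ ≤ t)
    (hc : c.FollowsProtocol Δ) {d e : ℕ} (hd : c.Credible Δ t d) (he : c.PublishedBy s e) :
    c.height e + c.numLagger Δ (s + Δ) (t - Δ) ≤ c.height d := by
  have h1 : c.height e ≤ c.height d := hd.2 e (he.mono (by linarith))
  have h2 : c.numLagger Δ (s + Δ) (t - Δ) ≤ (Set.Ioc (c.height e) (c.height d)).ncard := by
    -- Height is injective on laggers. The margin `Δ` at the left end puts them above `e`; the one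
    -- at the right end makes them old enough at time `t` to bound the height of `d` from below.
    refine Set.ncard_le_ncard_of_injOn c.height ?_ ?_ (Set.finite_Ioc _ _)
    · rintro l ⟨hl, hls, hlt⟩
      exact ⟨height_lt_of_publishedBy hc he hl.1 (c.pos_of_mined_pos (by linarith)) hls.le,
        hd.2 l ((publishedBy_mined hc hl.1).mono hlt)⟩
    · rintro l ⟨hl, -⟩ l' ⟨hl', -⟩ h
      exact hl.eq_of_height_eq hΔ hc hl' h
  rw [← Finset.coe_Ioc, Set.ncard_coe_finset, Nat.card_Ioc] at h2
  omega

theorem height_lt_of_mem_append {x d z : ℕ} {l : List ℕ} (h : c.chain d = c.chain x ++ l)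
    (hz : z ∈ l) : c.height x < c.height z := by
  by_contra hlt
  have hzd : z ∈ c.chain d := by rw [h]; exact List.mem_append_right _ hz
  have hxd : x ∈ c.chain d := by rw [h]; exact List.mem_append_left _ (c.mem_chain_self x)
  have hzx := c.mem_chain_of_height_le hzd hxd (not_lt.mp hlt)
  have hnd := c.nodup_chain d
  rw [h] at hnd
  exact List.disjoint_of_nodup_append hnd hzx hz

theorem mined_lt_of_mem_append {x d z : ℕ} {l : List ℕ} (h : c.chain d = c.chain x ++ l)
    (hz : z ∈ l) : c.mined x < c.mined z :=
  c.mined_lt_of_mem_of_height_lt (b := d)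
    (by rw [h]; exact List.mem_append_left _ (c.mem_chain_self x))
    (by rw [h]; exact List.mem_append_right _ hz) (height_lt_of_mem_append h hz)

theorem mined_mem_Ioc_of_mem_append {t : ℝ} {x d z : ℕ} {l : List ℕ} (hd : c.PublishedBy t d)
    (h : c.chain d = c.chain x ++ l) (hz : z ∈ l) : c.mined z ∈ Set.Ioc (c.mined x) t :=
  ⟨mined_lt_of_mem_append h hz, hd.mined_le (by rw [h]; exact List.mem_append_right _ hz)⟩

theorem countP_le_ncard {s t : ℝ} {l : List ℕ} (hl : l.Nodup)
    (hm : ∀ z ∈ l, c.mined z ∈ Set.Ioc s t) (p : ℕ → Prop) [DecidablePred p] :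
    l.countP (fun x => p x) ≤ {k | p k ∧ c.mined k ∈ Set.Ioc s t}.ncard := by
  rw [List.countP_eq_length_filter, ← List.toFinset_card_of_nodup (hl.filter _),
    ← Set.ncard_coe_finset]
  refine Set.ncard_le_ncard (fun k hk => ?_) (c.finite_mined_mem_Ioc p s t)
  simp only [List.coe_toFinset, List.mem_filter, decide_eq_true_eq, Set.mem_ofPred_eq] at hk
  exact ⟨hk.2, hm k hk.1⟩

theorem length_le_numHonest_add_numAdversarial {s t : ℝ} {l : List ℕ} (hl : l.Nodup)
    (hm : ∀ z ∈ l, c.mined z ∈ Set.Ioc s t) :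
    l.length ≤ c.numHonest s t + c.numAdversarial s t := by
  classical
  rw [List.length_eq_countP_add_countP (fun x => decide (x ∈ c.honest)) (l := l)]
  refine add_le_add (countP_le_ncard hl hm _) ?_
  have := countP_le_ncard hl hm (fun x => x ∉ c.honest)
  simpa [numAdversarial] using this

theorem nodup_of_chain_eq_append {d x : ℕ} {l : List ℕ} (h : c.chain d = c.chain x ++ l) :
    l.Nodup := by
  have hnd := c.nodup_chain d
  rw [h] at hnd
  exact hnd.of_append_right

end BlockTree

/-! ### Growth, quality and common prefix on good and typical outcomes. -/

section Parameters

variable {α β Δ δ : ℝ}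

theorem discount_pos : 0 < discount α Δ := Real.exp_pos _

theorem discount_lt_one (hα : 0 < α) (hΔ : 0 < Δ) : discount α Δ < 1 := by
  rw [discount, Real.exp_lt_one_iff]
  have := mul_pos hα hΔ
  linarith

theorem discount_sq_le (hα : 0 < α) (hΔ : 0 < Δ) : discount α Δ ^ 2 ≤ discount α Δ := by
  have h0 := discount_pos (α := α) (Δ := Δ)
  have h1 := discount_lt_one hα hΔ
  nlinarith

variable {c : BlockTree}

/-- The slack `81/40 δ` in the bound on `β` pays for the fluctuation `δ` of the adversarial count
and leaves `41/40 δ`, the same loss as in growth. -/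
theorem GoodEvent.numAdversarial_lt {s t : ℝ} (hst : s < t)
    (hαβ : β < (1 - 81 / 40 * δ) * discount α Δ ^ 2 * α) (h : GoodEvent α β Δ δ s t c) :
    (c.numAdversarial s t : ℝ) < (1 - 41 / 40 * δ) * discount α Δ ^ 2 * α * (t - s) := by
  have h1 := h.2.2.2
  have h2 := mul_lt_mul_of_pos_left hαβ (sub_pos.mpr hst)
  linarith

/-- Cutting `Δ` off both ends costs `2Δ`, at most `δ/40` of the length; this is how `δ` becomes
`41/40 δ`. -/
theorem threshold_le {s t : ℝ} (hδ : 0 < δ) (hst : 80 * Δ / δ ≤ t - s) (hΔ : 0 < Δ)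
    {r : ℝ} (hr : 0 ≤ r) :
    (1 - 41 / 40 * δ) * r * (t - s) ≤ (1 - δ) * (t - Δ - (s + Δ)) * r := by
  rw [div_le_iff₀ hδ] at hst
  have h2 : (1 - 41 / 40 * δ) * (t - s) ≤ (1 - δ) * (t - Δ - (s + Δ)) := by
    have := mul_pos hδ hΔ
    linarith
  have := mul_le_mul_of_nonneg_right h2 hr
  linarith

theorem GoodEvent.lt_numLagger {s t : ℝ} (hα : 0 < α) (hδ : 0 < δ) (hst : 80 * Δ / δ ≤ t - s)
    (hΔ : 0 < Δ) (h : GoodEvent α β Δ δ (s + Δ) (t - Δ) c) :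
    (1 - 41 / 40 * δ) * discount α Δ * α * (t - s) < c.numLagger Δ (s + Δ) (t - Δ) := by
  have h1 := h.2.1
  have := threshold_le hδ hst hΔ (mul_pos (discount_pos (α := α) (Δ := Δ)) hα).le
  linarith

theorem two_mul_le_of_div_le {L : ℝ} (hδ : 0 < δ) (hδ1 : δ ≤ 1) (hΔ : 0 < Δ)
    (h : 80 * Δ / δ ≤ L) : 2 * Δ ≤ L := by
  rw [div_le_iff₀ hδ] at h
  have hL : 0 ≤ L := by
    by_contra hL
    have := mul_neg_of_neg_of_pos (not_le.mp hL) hδ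
    linarith
  nlinarith

/-- Blockchain growth on a good event. -/
theorem GoodEvent.height_add_le {s t : ℝ} (hα : 0 < α) (hδ : 0 < δ) (hδ1 : δ ≤ 1)
    (hΔ : 0 < Δ) (hc : c.FollowsProtocol Δ) (hs : 0 ≤ s) (hst : 80 * Δ / δ ≤ t - s)
    (h : GoodEvent α β Δ δ (s + Δ) (t - Δ) c) {d e : ℕ} (hd : c.Credible Δ t d)
    (he : c.PublishedBy s e) :
    (c.height e : ℝ) + (1 - 41 / 40 * δ) * discount α Δ * α * (t - s) ≤ c.height d := by
  have h1 := BlockTree.height_add_numLagger_le hΔ hs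
    (by have := two_mul_le_of_div_le hδ hδ1 hΔ hst; linarith) hc hd he
  have h2 := h.lt_numLagger hα hδ hst hΔ
  have h3 : (c.height e : ℝ) + c.numLagger Δ (s + Δ) (t - Δ) ≤ c.height d := by exact_mod_cast h1
  linarith

/-- The last `k` blocks of a blockchain take much time on a typical event. -/
theorem TypicalEvent.mined_le {t τ : ℝ} {k : ℕ} (hα : 0 < α) (hΔ : 0 < Δ)
    (hτ : τ = k / (2 * α)) (hk : 0 < k) (hδ : 0 < δ) (hτt : τ ≤ t)
    (hαβ : β < (1 - 81 / 40 * δ) * discount α Δ ^ 2 * α) (hδ' : δ < 40 / 81)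
    (h : TypicalEvent α β Δ δ (t - τ + Δ) (t - Δ) c) {d x : ℕ} (hd : c.PublishedBy t d)
    (hx : x ∈ c.chain d) (hxk : c.height x + k ≤ c.height d) : c.mined x ≤ t - τ := by
  by_contra hlt
  rw [not_le] at hlt
  -- Otherwise the last `k` blocks are all mined in `(t - τ, t]`, where there are fewer than `(1 +
  -- δ)ατ` honest and `(1 - 41/40 δ)ατ` adversarial blocks, in total less than `2ατ = k`.
  have hG := h (t - τ) ⟨by linarith, by linarith⟩ t (by simp only [Set.mem_Ici]; linarith)
  obtain ⟨l, hl⟩ := c.chain_prefix_of_mem hx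
  have h1 := BlockTree.length_le_numHonest_add_numAdversarial
    (BlockTree.nodup_of_chain_eq_append hl.symm)
    (fun z hz => Set.Ioc_subset_Ioc_left hlt.le
      (BlockTree.mined_mem_Ioc_of_mem_append hd hl.symm hz))
  have h2 : k ≤ l.length := by
    have := congrArg List.length hl
    rw [List.length_append, BlockTree.length_chain, BlockTree.length_chain] at this
    omega
  have h3 : (k : ℝ) ≤ c.numHonest (t - τ) t + c.numAdversarial (t - τ) t := by
    exact_mod_cast h2.trans h1
  have hk' : (0 : ℝ) < k := by exact_mod_cast hk
  have hτ0 : 0 < τ := by rw [hτ]; positivity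
  have h4 := hG.1.2
  have h5 := hG.numAdversarial_lt (by linarith) hαβ
  have h6 : α * τ = k / 2 := by rw [hτ]; field_simp
  have h7 : discount α Δ ^ 2 ≤ 1 := (discount_sq_le hα hΔ).trans (discount_lt_one hα hΔ).le
  have h8 : (1 - 41 / 40 * δ) * discount α Δ ^ 2 * α * (t - (t - τ)) ≤
      (1 - 41 / 40 * δ) * (α * τ) := by
    have h9 : 0 ≤ (1 - 41 / 40 * δ) * (α * τ) := mul_nonneg (by linarith) (by positivity)
    have := mul_le_mul_of_nonneg_left h7 h9
    linarith
  have h10 : (1 + δ) * (t - (t - τ)) * α = (1 + δ) * (α * τ) := by ring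
  rw [h10] at h4
  rw [h6] at h4 h8
  nlinarith

/-- Blockchain quality on a typical event. -/
theorem TypicalEvent.quality {t τ : ℝ} {k : ℕ} (hα : 0 < α) (hΔ : 0 < Δ)
    (hτ : τ = k / (2 * α)) (hτΔ : 80 * Δ / δ ≤ τ) (hk : 0 < k) (hδ : 0 < δ) (hτt : τ ≤ t)
    (hαβ : β < (1 - 81 / 40 * δ) * discount α Δ ^ 2 * α) (hδ' : δ < 40 / 81)
    (hc : c.FollowsProtocol Δ)
    (h : TypicalEvent α β Δ δ (t - τ + Δ) (t - Δ) c) {d : ℕ} (hd : c.Credible Δ t d)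
    (hdk : k ≤ c.height d) :
    (1 - discount α Δ) * k ≤ c.honestAmongLast k d := by
  classical
  obtain ⟨y, hy, hyh, hyc⟩ := c.exists_chain_eq_rdrop hdk
  -- Growth must start from a blockchain known to be published. An honest block is published when
  -- mined, so the window begins at the last honest block `x` up to `y`; the extra blocks `l` are
  -- adversarial.
  obtain ⟨x, hx, l, hl, hlz⟩ := c.exists_last_honest y
  have hdec : c.chain d = c.chain x ++ (l ++ c.lastBlocks k d) := by
    rw [← List.append_assoc, ← hl, ← hyc, BlockTree.lastBlocks, List.rdrop, List.rtake,
      List.take_append_drop]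
  have hxy : x ∈ c.chain y := by rw [hl]; exact List.mem_append_left _ (c.mem_chain_self x)
  have hxd := c.mem_chain_trans hxy hy
  have hlen : c.height d = c.height x + (l.length + (c.lastBlocks k d).length) := by
    have := congrArg List.length hdec
    simp only [List.length_append, BlockTree.length_chain] at this
    omega
  have hlast : (c.lastBlocks k d).length = k := by
    simp only [BlockTree.lastBlocks, List.rtake, List.length_drop, BlockTree.length_chain]
    omega
  have hmx := h.mined_le hα hΔ hτ hk hδ hτt hαβ hδ' hd.1 hxd
    (by have := c.height_le_of_mem hxy; omega)
  have hts : 80 * Δ / δ ≤ t - c.mined x := by linarith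
  have htpos := two_mul_le_of_div_le hδ (by linarith) hΔ hts
  have hgrow := (h (c.mined x + Δ) ⟨by linarith [c.mined_nonneg x], by linarith⟩ (t - Δ)
    (by simp)).height_add_le hα hδ (by linarith) hΔ hc (c.mined_nonneg x) hts hd
    (BlockTree.publishedBy_mined hc hx)
  have hadv := (h (c.mined x) ⟨c.mined_nonneg x, by linarith⟩ t
    (by simp only [Set.mem_Ici]; linarith)).numAdversarial_lt (by linarith) hαβ
  have hcount := BlockTree.countP_le_ncard (BlockTree.nodup_of_chain_eq_append hdec)
    (fun z hz => BlockTree.mined_mem_Ioc_of_mem_append hd.1 hdec hz) (fun z => z ∉ c.honest)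
  rw [List.countP_append, List.countP_eq_length.mpr (by simpa using hlz)] at hcount
  have hsplit := List.length_eq_countP_add_countP (fun x => decide (x ∈ c.honest))
    (l := c.lastBlocks k d)
  have hadvlast : (c.lastBlocks k d).countP (fun z => decide (z ∉ c.honest)) + l.length ≤
      c.numAdversarial (c.mined x) t := by
    rw [add_comm]; exact hcount
  have hhon : c.honestAmongLast k d =
      (c.lastBlocks k d).countP (fun x => decide (x ∈ c.honest)) := by
    unfold BlockTree.honestAmongLast
    congr!
  have hsplit' : k = c.honestAmongLast k d +
      (c.lastBlocks k d).countP (fun z => decide (z ∉ c.honest)) := by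
    rw [hhon, ← hlast]
    simpa [hlast] using hsplit
  have e1 : (k : ℝ) + l.length ≤ c.honestAmongLast k d + c.numAdversarial (c.mined x) t := by
    exact_mod_cast (by omega : k + l.length ≤ c.honestAmongLast k d + c.numAdversarial _ t)
  have e2 : (c.height d : ℝ) = c.height x + (l.length + k) := by
    rw [hlast] at hlen; exact_mod_cast hlen
  have hg0 := discount_pos (α := α) (Δ := Δ)
  have hg1 := discount_lt_one hα hΔ
  have e3 : (1 - 41 / 40 * δ) * discount α Δ * α * (t - c.mined x) ≤ l.length + k := by linarith
  -- The bound on the adversarial count is `g` times the growth bound, so it is at most `g (l.length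
  -- + k)`. Removing the `l.length` adversarial blocks below depth `k` leaves at most `g k`.
  have e4 := mul_le_mul_of_nonneg_left e3 hg0.le
  have e5 : 0 ≤ (1 - discount α Δ) * (l.length : ℝ) :=
    mul_nonneg (by linarith) (Nat.cast_nonneg _)
  nlinarith

theorem TypicalEvent.le_height {t τ : ℝ} {k : ℕ} (hα : 0 < α) (hΔ : 0 < Δ)
    (hτΔ : 80 * Δ / δ ≤ τ) (hδ : 0 < δ) (hτt : τ ≤ t) (hδ' : δ < 40 / 81)
    (hkt : k / ((1 - 41 / 40 * δ) * discount α Δ * α) ≤ t)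
    (hc : c.FollowsProtocol Δ)
    (h : TypicalEvent α β Δ δ (t - τ + Δ) (t - Δ) c) {d : ℕ} (hd : c.Credible Δ t d) :
    k ≤ c.height d := by
  have hpos : 0 < (1 - 41 / 40 * δ) * discount α Δ * α :=
    mul_pos (mul_pos (by linarith) discount_pos) hα
  have hG := h (0 + Δ) ⟨by linarith, by linarith⟩ (t - Δ) (by simp)
  have h1 := hG.height_add_le hα hδ (by linarith) hΔ hc le_rfl (by linarith) hd
    (BlockTree.credible_zero hΔ hc).1
  rw [div_le_iff₀ hpos] at hkt
  rw [BlockTree.height_zero] at h1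
  have h2 : (k : ℝ) ≤ c.height d := by
    push_cast at h1
    linarith
  exact_mod_cast h2

/-- Credible blockchains of nearby times share all blocks that are deep enough. -/
theorem TypicalEvent.prefix_step {t τ r r' : ℝ} {k : ℕ} (hα : 0 < α) (hΔ : 0 < Δ)
    (hτ : τ = k / (2 * α)) (hτΔ : 80 * (1 + Δ) / δ ≤ τ) (hk : 0 < k) (hδ : 0 < δ) (hτt : τ ≤ t)
    (hαβ : β < (1 - 81 / 40 * δ) * discount α Δ ^ 2 * α) (hδ' : δ < 40 / 81)
    (hc : c.FollowsProtocol Δ)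
    (h : TypicalEvent α β Δ δ (t - τ + Δ) (t - Δ) c) {d y e e' : ℕ} (hd : c.PublishedBy t d)
    (hyd : y ∈ c.chain d) (hyk : c.height y + k ≤ c.height d + 1)
    (htr : t ≤ r') (hrr : r' ≤ r) (hr1 : r ≤ r' + 1) (he' : c.Credible Δ r' e')
    (hye' : y ∈ c.chain e') (he : c.Credible Δ r e) : y ∈ c.chain e := by
  classical
  by_contra hye
  -- The highest honest block common to the blockchains of `y` and `e`; the genesis block shows that
  -- there is one.
  obtain ⟨x, hx, hmax⟩ := ((c.chain y).toFinset.filter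
    (fun z => z ∈ c.honest ∧ z ∈ c.chain e)).exists_max_image c.height
    ⟨0, by simp [c.zero_mem_chain, c.genesis_honest]⟩
  simp only [Finset.mem_filter, List.mem_toFinset] at hx hmax
  obtain ⟨hxy, hxh, hxe⟩ := hx
  have hxne : x ≠ y := by rintro rfl; exact hye hxe
  have hxlt : c.height x < c.height y := by
    refine lt_of_le_of_ne (c.height_le_of_mem hxy) fun heq => hxne ?_
    exact c.eq_of_mem_of_height_eq hxy (c.mem_chain_self y) heq
  -- Only depth `k - 1` is required of `y`, because `x` is strictly lower.
  have hmx := h.mined_le hα hΔ hτ hk hδ hτt hαβ hδ' hd (c.mem_chain_trans hxy hyd) (by omega)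
  have hx0 := c.mined_nonneg x
  have hτΔ' : 80 * (1 + Δ) ≤ τ * δ := by rwa [div_le_iff₀ hδ] at hτΔ
  have hτ2 : 80 * (1 + Δ) ≤ τ := by nlinarith
  -- A common block at least as high as `y` on the blockchain of `e'` would carry `y` into that of
  -- `e`; so common blocks lie below `y`, where `x` is maximal.
  have hcommon : ∀ z, z ∈ c.chain e' → z ∈ c.chain e → z ∈ c.honest → c.height z ≤ c.height x := by
    intro z hz' hz hzh
    refine hmax z ⟨?_, hzh, hz⟩
    refine c.mem_chain_of_height_le hz' hye' ?_
    by_contra hlt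
    exact hye (c.mem_chain_trans (c.mem_chain_of_height_le hye' hz' (not_le.mp hlt).le) hz)
  -- Both blockchains reach the height of the loner `l`. If both blocks there were honest, both
  -- would be `l`, a common honest block above `x`.
  have hmatch : ∀ l, c.IsLoner Δ l → c.mined l ∈ Set.Ioc (c.mined x + Δ) (r' - Δ) →
      ∃ w, w ∉ c.honest ∧ c.mined w ∈ Set.Ioc (c.mined x) r ∧ c.height w = c.height l := by
    intro l hl ⟨hl1, hl2⟩
    have hpub := (BlockTree.publishedBy_mined hc hl.1.1)
    have hxl := BlockTree.height_lt_of_honest hΔ hc hxh hl.1.1 hl1.le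
    obtain ⟨u, hu, huh⟩ := c.exists_mem_chain_height_eq (he'.2 l (hpub.mono hl2))
    obtain ⟨v, hv, hvh⟩ := c.exists_mem_chain_height_eq (he.2 l (hpub.mono (by linarith)))
    have hum := c.mined_lt_of_mem_of_height_lt (c.mem_chain_trans hxy hye') hu (by omega)
    have hvm := c.mined_lt_of_mem_of_height_lt hxe hv (by omega)
    by_cases huhon : u ∈ c.honest
    · refine ⟨v, fun hvhon => ?_, ⟨hvm, he.1.mined_le hv⟩, hvh⟩
      have h1 := hl.eq_of_height_eq hΔ hc huhon huh
      have h2 := hl.eq_of_height_eq hΔ hc hvhon hvh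
      subst h1
      subst h2
      have := hcommon _ hu hv huhon
      omega
    · exact ⟨u, huhon, ⟨hum, (he'.1.mined_le hu).trans hrr⟩, huh⟩
  choose! w hw using hmatch
  have hle : c.numLoner Δ (c.mined x + Δ) (r' - Δ) ≤ c.numAdversarial (c.mined x) r := by
    refine Set.ncard_le_ncard_of_injOn w ?_ ?_ (c.finite_mined_mem_Ioc _ _ _)
    · rintro l ⟨hl, hlm⟩
      exact ⟨(hw l hl hlm).1, (hw l hl hlm).2.1⟩
    · rintro l ⟨hl, hlm⟩ l' ⟨hl', hlm'⟩ heq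
      refine hl'.eq_of_height_eq hΔ hc hl.1.1 ?_
      rw [← (hw l hl hlm).2.2, ← (hw l' hl' hlm').2.2, heq]
  have hY := (h (c.mined x + Δ) ⟨by linarith, by linarith⟩ (r' - Δ)
    (by simp only [Set.mem_Ici]; linarith)).2.2.1
  have hZ := (h (c.mined x) ⟨hx0, by linarith⟩ r
    (by simp only [Set.mem_Ici]; linarith)).numAdversarial_lt (by linarith) hαβ
  have hle' : (c.numLoner Δ (c.mined x + Δ) (r' - Δ) : ℝ) ≤ c.numAdversarial (c.mined x) r := by
    exact_mod_cast hle
  have hga : 0 < discount α Δ ^ 2 * α := mul_pos (pow_pos discount_pos 2) hα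
  -- The window of the loners is shorter by at most `1 + 2Δ`, which is below `δτ/40`. The unit time
  -- step accounts for `1 + Δ` instead of `Δ` in the threshold.
  have hlen : (1 - 41 / 40 * δ) * (r - c.mined x) ≤
      (1 - δ) * (r' - Δ - (c.mined x + Δ)) := by
    have h1 : 80 * (1 + Δ) ≤ (r - c.mined x) * δ :=
      hτΔ'.trans (mul_le_mul_of_nonneg_right (by linarith) hδ.le)
    have h2 : (1 - δ) * (r' - Δ - (c.mined x + Δ)) ≥ (1 - δ) * (r - 1 - 2 * Δ - c.mined x) :=
      mul_le_mul_of_nonneg_left (by linarith) (by linarith)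
    nlinarith
  have := mul_le_mul_of_nonneg_right hlen hga.le
  linarith

/-- The common prefix property on a typical event. -/
theorem TypicalEvent.deepPrefix_prefix {t τ : ℝ} {k : ℕ} (hα : 0 < α) (hΔ : 0 < Δ)
    (hτ : τ = k / (2 * α)) (hτΔ : 80 * (1 + Δ) / δ ≤ τ) (hk : 0 < k) (hδ : 0 < δ) (hτt : τ ≤ t)
    (hτ0 : 0 ≤ τ) (hαβ : β < (1 - 81 / 40 * δ) * discount α Δ ^ 2 * α) (hδ' : δ < 40 / 81)
    (hc : c.FollowsProtocol Δ)
    (h : TypicalEvent α β Δ δ (t - τ + Δ) (t - Δ) c) {d : ℕ} (hd : c.Credible Δ t d)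
    (hdk : k - 1 ≤ c.height d) : c.PermanentAfter Δ t (c.deepPrefix (k - 1) d) := by
  obtain ⟨y, hyd, hyh, hyc⟩ := c.exists_chain_eq_rdrop hdk
  -- A direct comparison of times `t` and `r` would give the adversary too long a window, hence the
  -- induction. The depth of `y` is always measured in `d`, at the fixed time `t`.
  have key : ∀ n : ℕ, ∀ r, t ≤ r → r ≤ t + n → ∀ e, c.Credible Δ r e → y ∈ c.chain e := by
    intro n
    induction n with
    | zero =>
      intro r htr hrn e he
      exact h.prefix_step hα hΔ hτ hτΔ hk hδ hτt hαβ hδ' hc hd.1 hyd (by omega) le_rfl htr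
        (by push_cast at hrn; linarith) hd hyd he
    | succ n ih =>
      intro r htr hrn e he
      push_cast at hrn
      rcases le_total r (t + 1) with hr | hr
      · exact h.prefix_step hα hΔ hτ hτΔ hk hδ hτt hαβ hδ' hc hd.1 hyd (by omega) le_rfl htr
          hr hd hyd he
      · obtain ⟨e', he'⟩ := BlockTree.exists_credible (t := r - 1) hΔ hc (by linarith)
        exact h.prefix_step hα hΔ hτ hτΔ hk hδ hτt hαβ hδ' hc hd.1 hyd (by omega)
          (r' := r - 1) (by linarith) (by linarith) (by linarith) he'
          (ih (r - 1) (by linarith) (by linarith) e' he') he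
  intro r hr e he
  rw [BlockTree.deepPrefix, hyc]
  obtain ⟨n, hn⟩ := exists_nat_ge (r - t)
  exact c.chain_prefix_of_mem (key n r hr (by linarith) e he)

end Parameters

/-! ### Chernoff bounds for Poisson variables. -/

theorem one_sub_exp_neg_ge {θ : ℝ} (hθ : 0 ≤ θ) : θ - θ ^ 2 / 2 ≤ 1 - Real.exp (-θ) := by
  have h1 := Real.quadratic_le_exp_of_nonneg hθ
  have h2 : Real.exp (-θ) * Real.exp θ = 1 := by rw [← Real.exp_add]; simp
  have h3 := Real.exp_pos (-θ)
  have h4 : Real.exp (-θ) * (1 + θ + θ ^ 2 / 2) ≤ 1 := by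
    calc _ ≤ Real.exp (-θ) * Real.exp θ := mul_le_mul_of_nonneg_left h1 h3.le
      _ = 1 := h2
  by_contra hlt
  have h5 : 1 - θ + θ ^ 2 / 2 < Real.exp (-θ) := by linarith
  have h6 : 0 < 1 + θ + θ ^ 2 / 2 := by positivity
  have h7 := mul_lt_mul_of_pos_right h5 h6
  have : (1 - θ + θ ^ 2 / 2) * (1 + θ + θ ^ 2 / 2) = 1 + θ ^ 4 / 4 := by ring
  have : 0 ≤ θ ^ 4 := by positivity
  linarith

theorem exp_sub_one_le {θ : ℝ} (hθ : 0 ≤ θ) (hθ1 : θ ≤ 1) : Real.exp θ - 1 ≤ θ + θ ^ 2 := by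
  have := abs_le.mp (Real.abs_exp_sub_one_sub_id_le (abs_le.mpr ⟨by linarith, hθ1⟩))
  linarith [this.2]

section Poisson

theorem hasSum_exp_mul_poisson (r : ℝ≥0) (θ : ℝ) :
    HasSum (fun n : ℕ => Real.exp (-r) * r ^ n / (n.factorial : ℝ) * Real.exp (θ * n))
      (Real.exp (r * (Real.exp θ - 1))) := by
  have h := (NormedSpace.expSeries_div_hasSum_exp ((r : ℝ) * Real.exp θ)).mul_left
    (Real.exp (-r))
  rw [← Real.exp_eq_exp_ℝ, ← Real.exp_add] at h
  convert! h using 1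
  · funext n
    rw [mul_pow, ← Real.exp_nat_mul, mul_comm θ]
    ring
  · congr 1
    ring

theorem integrable_exp_mul_poissonMeasure (r : ℝ≥0) (θ : ℝ) :
    Integrable (fun n : ℕ => Real.exp (θ * n)) (poissonMeasure r) := by
  rw [integrable_poissonMeasure_iff]
  simpa only [Real.norm_eq_abs, Real.abs_exp] using (hasSum_exp_mul_poisson r θ).summable

theorem mgf_poissonMeasure (r : ℝ≥0) (θ : ℝ) :
    mgf (fun n : ℕ => (n : ℝ)) (poissonMeasure r) θ = Real.exp (r * (Real.exp θ - 1)) := by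
  rw [mgf, integral_poissonMeasure]
  simpa only [smul_eq_mul] using (hasSum_exp_mul_poisson r θ).tsum_eq

/-- Chernoff bound for the upper tail of a Poisson variable. -/
theorem poissonMeasure_real_ge_le (r : ℝ≥0) {θ : ℝ} (hθ : 0 ≤ θ) (hθ1 : θ ≤ 1) (x : ℝ) :
    (poissonMeasure r).real {n | x ≤ n} ≤ Real.exp (r * (θ + θ ^ 2) - θ * x) := by
  refine (measure_ge_le_exp_mul_mgf x hθ (integrable_exp_mul_poissonMeasure r θ)).trans ?_
  rw [mgf_poissonMeasure, ← Real.exp_add, Real.exp_le_exp]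
  have := mul_le_mul_of_nonneg_left (exp_sub_one_le hθ hθ1) r.2
  simp only [NNReal.val_eq_coe] at this
  linarith

/-- Chernoff bound for the lower tail of a Poisson variable. -/
theorem poissonMeasure_real_le_le (r : ℝ≥0) {θ : ℝ} (hθ : 0 ≤ θ) (x : ℝ) :
    (poissonMeasure r).real {n | (n : ℝ) ≤ x} ≤ Real.exp (θ * x - r * (θ - θ ^ 2 / 2)) := by
  refine (measure_le_le_exp_mul_mgf x (neg_nonpos.mpr hθ)
    (integrable_exp_mul_poissonMeasure r (-θ))).trans ?_
  rw [mgf_poissonMeasure, ← Real.exp_add, Real.exp_le_exp]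
  have := mul_le_mul_of_nonneg_left (one_sub_exp_neg_ge hθ) r.2
  simp only [NNReal.val_eq_coe] at this
  linarith

end Poisson

/-! ### Measurability, and tails of the honest and adversarial counts. -/

variable {Ω : Type*} [MeasurableSpace Ω]

/-- The count is the pointwise limit of the counts over the first `N` blocks, which are eventually
constant for each outcome. -/
theorem measurable_ncard_mined {T : Ω → BlockTree} {p : ℕ → Ω → Prop}
    (hT : ∀ k, Measurable fun ω => (T ω).mined k) (hp : ∀ k, MeasurableSet {ω | p k ω})
    (s t : ℝ) :
    Measurable fun ω => {k | p k ω ∧ (T ω).mined k ∈ Set.Ioc s t}.ncard := by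
  classical
  have hset : ∀ k, MeasurableSet {ω | p k ω ∧ (T ω).mined k ∈ Set.Ioc s t} := fun k =>
    (hp k).inter (hT k measurableSet_Ioc)
  refine measurable_of_tendsto_metrizable (f := fun (N : ℕ) ω =>
    ∑ k ∈ Finset.range N, if p k ω ∧ (T ω).mined k ∈ Set.Ioc s t then 1 else 0) ?_ ?_
  · intro N
    exact Finset.measurable_sum _ fun k _ => Measurable.ite (hset k) measurable_const
      measurable_const
  · rw [tendsto_pi_nhds]
    intro ω
    have hfin := (T ω).finite_mined_mem_Ioc (fun k => p k ω) s t
    obtain ⟨B, hB⟩ := hfin.bddAbove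
    refine tendsto_const_nhds.congr' ?_
    filter_upwards [eventually_gt_atTop B] with N hN
    rw [← Finset.card_filter, ← Set.ncard_coe_finset]
    congr 1
    ext k
    simp only [Finset.coe_filter, Finset.mem_range, Set.mem_ofPred_eq]
    exact ⟨fun h => ⟨(hB h).trans_lt hN, h⟩, fun h => h.2⟩

namespace BlockTree

theorem numHonest_add (c : BlockTree) {r s t : ℝ} (hrs : r ≤ s) (hst : s ≤ t) :
    c.numHonest r s + c.numHonest s t = c.numHonest r t := by
  rw [numHonest, numHonest, numHonest, ← Set.ncard_union_eq ?_
    (c.finite_mined_mem_Ioc _ _ _) (c.finite_mined_mem_Ioc _ _ _)]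
  · congr 1
    ext k
    simp only [Set.mem_union, Set.mem_ofPred_eq, ← and_or_left]
    rw [← Set.mem_union, Set.Ioc_union_Ioc_eq_Ioc hrs hst]
  · rw [Set.disjoint_left]
    rintro k ⟨-, hk⟩ ⟨-, hk'⟩
    exact absurd hk.2 (not_le.mpr hk'.1)

theorem numHonest_mono (c : BlockTree) {r s s' r' : ℝ} (h : r' ≤ r) (h' : s ≤ s') :
    c.numHonest r s ≤ c.numHonest r' s' :=
  Set.ncard_le_ncard (fun _ hk => ⟨hk.1, Set.Ioc_subset_Ioc h h' hk.2⟩)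
    (c.finite_mined_mem_Ioc _ _ _)

theorem numLagger_mono (c : BlockTree) (Δ : ℝ) {r s s' r' : ℝ} (h : r' ≤ r) (h' : s ≤ s') :
    c.numLagger Δ r s ≤ c.numLagger Δ r' s' :=
  Set.ncard_le_ncard (fun _ hk => ⟨hk.1, Set.Ioc_subset_Ioc h h' hk.2⟩)
    (c.finite_mined_mem_Ioc _ _ _)

theorem numLoner_mono (c : BlockTree) (Δ : ℝ) {r s s' r' : ℝ} (h : r' ≤ r) (h' : s ≤ s') :
    c.numLoner Δ r s ≤ c.numLoner Δ r' s' :=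
  Set.ncard_le_ncard (fun _ hk => ⟨hk.1, Set.Ioc_subset_Ioc h h' hk.2⟩)
    (c.finite_mined_mem_Ioc _ _ _)

theorem numAdversarial_mono (c : BlockTree) {r s s' r' : ℝ} (h : r' ≤ r) (h' : s ≤ s') :
    c.numAdversarial r s ≤ c.numAdversarial r' s' :=
  Set.ncard_le_ncard (fun _ hk => ⟨hk.1, Set.Ioc_subset_Ioc h h' hk.2⟩)
    (c.finite_mined_mem_Ioc _ _ _)

theorem numHonest_eq_sub (c : BlockTree) {s t : ℝ} (hs : 0 ≤ s) (hst : s ≤ t) :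
    c.numHonest s t = c.numHonest 0 t - c.numHonest 0 s := by
  have := c.numHonest_add hs hst
  omega

end BlockTree

namespace Model

variable {P : Measure Ω} {m : ℕ} {α β Δ : ℝ} (M : Model P m α β Δ)

theorem measurable_numHonest (j : Fin (m + 1)) (s t : ℝ) :
    Measurable fun ω => (M.tree j ω).numHonest s t :=
  measurable_ncard_mined (M.measurable_mined j) (M.measurable_honest j) s t

theorem measurable_numAdversarial (j : Fin (m + 1)) (s t : ℝ) :
    Measurable fun ω => (M.tree j ω).numAdversarial s t :=
  measurable_ncard_mined (M.measurable_mined j) (fun k => (M.measurable_honest j k).compl) s t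

theorem hasLaw_numHonest (j : Fin (m + 1)) {s t : ℝ} (hs : 0 ≤ s) (hst : s ≤ t) :
    HasLaw (fun ω => (M.tree j ω).numHonest s t)
      (poissonMeasure (α.toNNReal * (t - s).toNNReal)) P := by
  have h := (M.honest_poisson j).law_increments s.toNNReal t.toNNReal (Real.toNNReal_mono hst)
  have e : t.toNNReal - s.toNNReal = (t - s).toNNReal := NNReal.eq <| by
    rw [NNReal.coe_sub (Real.toNNReal_mono hst), Real.coe_toNNReal _ hs,
      Real.coe_toNNReal _ (hs.trans hst), Real.coe_toNNReal _ (sub_nonneg.mpr hst)]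
  rw [e] at h
  simp only [Real.coe_toNNReal _ hs, Real.coe_toNNReal _ (hs.trans hst)] at h
  simp_rw [(M.tree j _).numHonest_eq_sub hs hst]
  exact h

theorem coe_rate {s t : ℝ} (hα : 0 ≤ α) (hst : s ≤ t) :
    ((α.toNNReal * (t - s).toNNReal : ℝ≥0) : ℝ) = α * (t - s) := by
  rw [NNReal.coe_mul, Real.coe_toNNReal _ hα, Real.coe_toNNReal _ (sub_nonneg.mpr hst)]

theorem prob_numHonest_ge_le (j : Fin (m + 1)) (hα : 0 ≤ α) {s t θ : ℝ} (hs : 0 ≤ s) (hst : s ≤ t)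
    (hθ : 0 ≤ θ) (hθ1 : θ ≤ 1) (x : ℝ) :
    P.real {ω | x ≤ (M.tree j ω).numHonest s t} ≤
      Real.exp (α * (t - s) * (θ + θ ^ 2) - θ * x) := by
  have h := poissonMeasure_real_ge_le (α.toNNReal * (t - s).toNNReal) hθ hθ1 x
  rw [coe_rate hα hst] at h
  rwa [(M.hasLaw_numHonest j hs hst).measureReal_eq (p := fun n : ℕ => x ≤ n) (.of_discrete)]

theorem prob_numHonest_le_le (j : Fin (m + 1)) (hα : 0 ≤ α) {s t θ : ℝ} (hs : 0 ≤ s) (hst : s ≤ t)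
    (hθ : 0 ≤ θ) (x : ℝ) :
    P.real {ω | ((M.tree j ω).numHonest s t : ℝ) ≤ x} ≤
      Real.exp (θ * x - α * (t - s) * (θ - θ ^ 2 / 2)) := by
  have h := poissonMeasure_real_le_le (α.toNNReal * (t - s).toNNReal) hθ x
  rw [coe_rate hα hst] at h
  rwa [(M.hasLaw_numHonest j hs hst).measureReal_eq (p := fun n : ℕ => (n : ℝ) ≤ x) (.of_discrete)]

theorem prob_numAdversarial_ge_le [IsProbabilityMeasure P] (j : Fin (m + 1)) (hβ : 0 ≤ β)
    {s t θ : ℝ} (hs : 0 ≤ s) (hst : s < t) (hθ : 0 ≤ θ) (hθ1 : θ ≤ 1) {x : ℝ} (hx : 0 < x) :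
    P.real {ω | x ≤ (M.tree j ω).numAdversarial s t} ≤
      Real.exp (β * (t - s) * (θ + θ ^ 2) - θ * x) := by
  have h := poissonMeasure_real_ge_le (β.toNNReal * (t - s).toNNReal) hθ hθ1 x
  rw [coe_rate hβ hst.le] at h
  refine le_trans ?_ h
  -- With `n + 1 = ⌈x⌉`, the upper tail is the complement of `Z ≤ n`, so the domination of
  -- distribution functions transfers the Poisson bound.
  obtain ⟨n, hn⟩ := Nat.exists_eq_succ_of_ne_zero (Nat.ceil_pos.mpr hx).ne'
  have key : ∀ k : ℕ, x ≤ k ↔ ¬ k ≤ n := fun k => by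
    rw [← Nat.ceil_le, hn, Nat.succ_le_iff, not_le]
  simp_rw [key]
  have hmeas : MeasurableSet {ω | (M.tree j ω).numAdversarial s t ≤ n} :=
    M.measurable_numAdversarial j s t (MeasurableSet.of_discrete (s := {k | k ≤ n}))
  have e1 : {ω | ¬ (M.tree j ω).numAdversarial s t ≤ n} =
      {ω | (M.tree j ω).numAdversarial s t ≤ n}ᶜ := rfl
  have e2 : {k : ℕ | ¬ k ≤ n} = ((Finset.range (n + 1) : Finset ℕ) : Set ℕ)ᶜ := by
    ext k; simp
  rw [e1, e2, probReal_compl_eq_one_sub hmeas, probReal_compl_eq_one_sub (.of_discrete),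
    ← sum_measureReal_singleton]
  have h3 := M.adversarial_le j s t hs hst n
  simp_rw [poissonMeasure_real_singleton, coe_rate hβ hst.le]
  rw [Finset.mul_sum] at h3
  simp_rw [mul_div_assoc]
  linarith

end Model

/-! ### Isolated cells in an independent Poisson sequence. -/

section Cells

/-- Cell `i` contains exactly one point, and the `K` cells before it and the `R` cells after it
contain none. -/
def Isolated (K R : ℕ) (n : ℕ → ℕ) (i : ℕ) : Prop :=
  n i = 1 ∧ ∀ l ∈ Finset.Icc (i - K) (i + R), l ≠ i → n l = 0

/-- There is an isolated cell in the group `b + 1`, where each group consists of `K` consecutive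
cells. -/
def HasIsolated (K R : ℕ) (b : ℕ) (n : ℕ → ℕ) : Prop :=
  ∃ i ∈ Finset.Ico ((b + 1) * K) ((b + 2) * K), Isolated K R n i

open Classical in
/-- The indicator of `HasIsolated`. -/
def isolatedIndicator (K R : ℕ) (b : ℕ) (n : ℕ → ℕ) : ℝ :=
  if HasIsolated K R b n then 1 else 0

variable {K R : ℕ}

/-- A cell of group `b + 1` looks at most `K` cells either way, hence only into groups `b` to `b +
2`. So indices that differ by 3 use disjoint cells. -/
theorem dependsOn_isolatedIndicator (hR : R ≤ K) (b : ℕ) :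
    DependsOn (isolatedIndicator K R b) (Finset.Ico (b * K) ((b + 3) * K) : Set ℕ) := by
  intro x y hxy
  have key : HasIsolated K R b x ↔ HasIsolated K R b y := by
    refine exists_congr fun i => and_congr_right fun hi => ?_
    rw [Finset.mem_Ico] at hi
    have h1 : (b + 1) * K = b * K + K := by ring
    have h2 : (b + 2) * K = b * K + 2 * K := by ring
    have h3 : (b + 3) * K = b * K + 3 * K := by ring
    have e : ∀ l ∈ Finset.Icc (i - K) (i + R), x l = y l := by
      intro l hl
      rw [Finset.mem_Icc] at hl
      exact hxy l (by rw [Finset.coe_Ico, Set.mem_Ico]; omega)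
    rw [Isolated, Isolated, e i (by rw [Finset.mem_Icc]; omega)]
    refine and_congr_right fun _ => forall₂_congr fun l hl => ?_
    rw [e l hl]
  by_cases h : HasIsolated K R b x
  · simp [isolatedIndicator, h, key.mp h]
  · simp [isolatedIndicator, h, mt key.mpr h]

variable {Ω : Type*} [MeasurableSpace Ω] {P : Measure Ω} {ξ : ℕ → Ω → ℕ}

/-- Extension by zero of a sequence defined on a finite set. -/
def extendZero (S : Finset ℕ) (v : S → ℕ) (i : ℕ) : ℕ := if h : i ∈ S then v ⟨i, h⟩ else 0

theorem eq_extendZero {f : (ℕ → ℕ) → ℝ} {S : Finset ℕ} (hf : DependsOn f (S : Set ℕ))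
    (n : ℕ → ℕ) : f n = f (extendZero S fun i => n i) :=
  hf fun i hi => by simp [extendZero, Finset.mem_coe.mp hi]

theorem measurable_comp_of_dependsOn (hξ : ∀ i, Measurable (ξ i)) {f : (ℕ → ℕ) → ℝ}
    {S : Finset ℕ} (hf : DependsOn f (S : Set ℕ)) : Measurable fun ω => f fun i => ξ i ω := by
  rw [show (fun ω => f fun i => ξ i ω) = fun ω => f (extendZero S fun i => ξ i ω) from
    funext fun ω => eq_extendZero hf _]
  exact (Measurable.of_discrete (f := fun v : S → ℕ => f (extendZero S v))).comp
    (measurable_pi_lambda _ fun i => hξ i)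

theorem indepFun_of_dependsOn (hξ : ∀ i, Measurable (ξ i)) (hind : iIndepFun ξ P)
    {f g : (ℕ → ℕ) → ℝ} {S T : Finset ℕ} (hST : Disjoint S T) (hf : DependsOn f (S : Set ℕ))
    (hg : DependsOn g (T : Set ℕ)) :
    IndepFun (fun ω => f fun i => ξ i ω) (fun ω => g fun i => ξ i ω) P := by
  rw [show (fun ω => f fun i => ξ i ω) = fun ω => f (extendZero S fun i => ξ i ω) from
    funext fun ω => eq_extendZero hf _, show (fun ω => g fun i => ξ i ω) =
    fun ω => g (extendZero T fun i => ξ i ω) from funext fun ω => eq_extendZero hg _]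
  exact (hind.indepFun_finset S T hST hξ).comp
    (Measurable.of_discrete (f := fun v : S → ℕ => f (extendZero S v)))
    (Measurable.of_discrete (f := fun v : T → ℕ => g (extendZero T v)))

variable {r : ℝ≥0}

/-- Each of the `K + R + 1` independent cells contributes `e^{-r}`, and the occupied one a further
factor `r`. The condition `K ≤ i` keeps `i - K` from being truncated. -/
theorem prob_isolated (hind : iIndepFun ξ P) (hlaw : ∀ i, HasLaw (ξ i) (poissonMeasure r) P)
    {i : ℕ} (hi : K ≤ i) :
    P {ω | Isolated K R (fun l => ξ l ω) i} =
      ENNReal.ofReal (r * Real.exp (-(r * (K + R + 1)))) := by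
  classical
  have hset : {ω | Isolated K R (fun l => ξ l ω) i} =
      ⋂ l ∈ Finset.Icc (i - K) (i + R), ξ l ⁻¹' {if l = i then 1 else 0} := by
    ext ω
    simp only [Isolated, Set.mem_ofPred_eq, Set.mem_iInter, Set.mem_preimage, Set.mem_singleton_iff]
    constructor
    · rintro ⟨h1, h2⟩ l hl
      split_ifs with h
      · rw [h, h1]
      · exact h2 l hl h
    · intro h
      refine ⟨?_, fun l hl hne => ?_⟩
      · simpa using h i (by rw [Finset.mem_Icc]; omega)
      · simpa [hne] using h l hl
  rw [hset, hind.measure_inter_preimage_eq_mul _ (fun _ _ => .of_discrete)]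
  have hp : ∀ l, P (ξ l ⁻¹' {if l = i then 1 else 0}) =
      ENNReal.ofReal (Real.exp (-r)) * if l = i then ENNReal.ofReal r else 1 := by
    intro l
    have := (hlaw l).measure_eq (p := fun n => n = if l = i then 1 else 0) .of_discrete
    rw [Set.ofPred_eq_eq_singleton, poissonMeasure_singleton] at this
    refine this.trans ?_
    split_ifs
    · rw [← ENNReal.ofReal_mul (Real.exp_nonneg _)]; simp
    · simp
  simp_rw [hp]
  rw [Finset.prod_mul_distrib, Finset.prod_const, Finset.prod_ite_eq' _ i, if_pos
    (by rw [Finset.mem_Icc]; omega), Nat.card_Icc, ← ENNReal.ofReal_pow (Real.exp_nonneg _),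
    ← ENNReal.ofReal_mul (by positivity), ← Real.exp_nat_mul, mul_comm,
    show i + R + 1 - (i - K) = K + R + 1 by omega]
  congr 3
  push_cast
  ring

theorem prob_hasIsolated (hξ : ∀ i, Measurable (ξ i)) (hind : iIndepFun ξ P)
    (hlaw : ∀ i, HasLaw (ξ i) (poissonMeasure r) P) (b : ℕ) :
    P.real {ω | HasIsolated K R b fun l => ξ l ω} =
      K * (r * Real.exp (-(r * (K + R + 1)))) := by
  have hset : {ω | HasIsolated K R b fun l => ξ l ω} =
      ⋃ i ∈ Finset.Ico ((b + 1) * K) ((b + 2) * K), {ω | Isolated K R (fun l => ξ l ω) i} := by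
    ext ω; simp [HasIsolated]
  have h1 : (b + 1) * K = b * K + K := by ring
  have h2 : (b + 2) * K = b * K + 2 * K := by ring
  rw [measureReal_def, hset, measure_biUnion_finset]
  · rw [Finset.sum_congr rfl (g := fun _ => ENNReal.ofReal (r * Real.exp (-(r * (K + R + 1)))))]
    · rw [Finset.sum_const, Nat.card_Ico, show (b + 2) * K - (b + 1) * K = K by omega,
        nsmul_eq_mul, ENNReal.toReal_mul, ENNReal.toReal_natCast,
        ENNReal.toReal_ofReal (by positivity)]
    · intro i hi
      rw [Finset.mem_Ico] at hi
      exact prob_isolated hind hlaw (by omega)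
  -- Two cells of one group are less than `K` apart, so the earlier is among the cells that must be
  -- empty if the later is isolated. Disjointness makes the probability exactly `K` times that of a
  -- single cell.
  · intro i hi i' hi' hne
    simp only [Finset.coe_Ico, Set.mem_Ico] at hi hi'
    rw [Function.onFun, Set.disjoint_left]
    rintro ω ⟨hω, hω'⟩ ⟨hω2, hω2'⟩
    rcases lt_or_gt_of_ne hne with h | h
    · have := hω2' i (by rw [Finset.mem_Icc]; omega) hne
      omega
    · have := hω' i' (by rw [Finset.mem_Icc]; omega) hne.symm
      omega
  · intro i _
    have hd : {ω | Isolated K R (fun l => ξ l ω) i} =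
        {ω | ξ i ω = 1} ∩ ⋂ l ∈ Finset.Icc (i - K) (i + R), {ω | l ≠ i → ξ l ω = 0} := by
      ext ω; simp [Isolated]
    rw [hd]
    refine (hξ i (measurableSet_singleton 1)).inter (Finset.measurableSet_biInter _ fun l _ => ?_)
    by_cases hl : l = i
    · simp [hl]
    · convert! hξ l (measurableSet_singleton 0) using 1
      ext ω
      simp [hl]

theorem isolatedIndicator_mem_Icc (b : ℕ) (n : ℕ → ℕ) :
    isolatedIndicator K R b n ∈ Set.Icc (0 : ℝ) 1 := by
  unfold isolatedIndicator
  split_ifs <;> simp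

variable [IsProbabilityMeasure P]

theorem mgf_isolatedIndicator (hξ : ∀ i, Measurable (ξ i)) (hind : iIndepFun ξ P)
    (hlaw : ∀ i, HasLaw (ξ i) (poissonMeasure r) P) (hR : R ≤ K) (b : ℕ) (φ : ℝ) :
    mgf (fun ω => isolatedIndicator K R b fun i => ξ i ω) P (-φ) =
      1 - K * (r * Real.exp (-(r * (K + R + 1)))) * (1 - Real.exp (-φ)) := by
  classical
  have hm := measurable_comp_of_dependsOn hξ (dependsOn_isolatedIndicator hR b)
  have hms : MeasurableSet {ω | HasIsolated K R b fun l => ξ l ω} := by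
    convert! hm (measurableSet_singleton 1) using 1
    ext ω
    simp [isolatedIndicator]
  have hpt : ∀ ω, Real.exp (-φ * isolatedIndicator K R b fun i => ξ i ω) =
      1 - {ω | HasIsolated K R b fun l => ξ l ω}.indicator (fun _ => 1 - Real.exp (-φ)) ω := by
    intro ω
    by_cases h : HasIsolated K R b fun l => ξ l ω
    · simp [isolatedIndicator, h]
    · simp [isolatedIndicator, h]
  rw [mgf]
  simp_rw [hpt]
  rw [integral_sub (integrable_const _) ((integrable_const _).indicator hms),
    integral_indicator_const _ hms, prob_hasIsolated hξ hind hlaw]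
  simp

theorem dependsOn_sum_isolatedIndicator (hR : R ≤ K) (ρ m : ℕ) :
    DependsOn (fun n => ∑ q ∈ Finset.range m, isolatedIndicator K R (ρ + 3 * q) n)
      (Finset.range ((ρ + 3 * m) * K) : Set ℕ) := by
  intro x y hxy
  refine Finset.sum_congr rfl fun q hq => dependsOn_isolatedIndicator hR _ fun i hi => hxy i ?_
  rw [Finset.mem_range] at hq
  simp only [Finset.coe_Ico, Set.mem_Ico, Finset.coe_range, Set.mem_Iio] at hi ⊢
  exact hi.2.trans_le (Nat.mul_le_mul_right _ (by omega))

theorem mgf_sum_isolatedIndicator (hξ : ∀ i, Measurable (ξ i)) (hind : iIndepFun ξ P)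
    (hlaw : ∀ i, HasLaw (ξ i) (poissonMeasure r) P) (hR : R ≤ K) (ρ m : ℕ) (φ : ℝ) :
    mgf (fun ω => ∑ q ∈ Finset.range m, isolatedIndicator K R (ρ + 3 * q) fun i => ξ i ω) P (-φ) =
      (1 - K * (r * Real.exp (-(r * (K + R + 1)))) * (1 - Real.exp (-φ))) ^ m := by
  induction m with
  | zero => simp [mgf]
  | succ m ih =>
    have hdis : Disjoint (Finset.range ((ρ + 3 * m) * K))
        (Finset.Ico ((ρ + 3 * m) * K) ((ρ + 3 * m + 3) * K)) := by
      rw [Finset.disjoint_left]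
      intro i hi hi'
      rw [Finset.mem_range] at hi
      rw [Finset.mem_Ico] at hi'
      omega
    have hi := indepFun_of_dependsOn hξ hind hdis (dependsOn_sum_isolatedIndicator hR ρ m)
      (dependsOn_isolatedIndicator hR (ρ + 3 * m))
    have hadd := hi.mgf_add' (t := -φ)
      (measurable_comp_of_dependsOn hξ
        (dependsOn_sum_isolatedIndicator hR ρ m)).aestronglyMeasurable
      (measurable_comp_of_dependsOn hξ
        (dependsOn_isolatedIndicator hR (ρ + 3 * m))).aestronglyMeasurable
    rw [pow_succ, ← ih, ← mgf_isolatedIndicator hξ hind hlaw hR (ρ + 3 * m), ← hadd]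
    congr 1
    funext ω
    simp only [Pi.add_apply, Finset.sum_range_succ]

theorem prob_sum_isolatedIndicator_le (hξ : ∀ i, Measurable (ξ i)) (hind : iIndepFun ξ P)
    (hlaw : ∀ i, HasLaw (ξ i) (poissonMeasure r) P) (hR : R ≤ K) (ρ m : ℕ) {φ : ℝ} (hφ : 0 ≤ φ)
    (x : ℝ) :
    P.real {ω | (∑ q ∈ Finset.range m, isolatedIndicator K R (ρ + 3 * q) fun i => ξ i ω) ≤ x} ≤
      Real.exp (φ * x - m * (K * (r * Real.exp (-(r * (K + R + 1)))) * (φ - φ ^ 2 / 2))) := by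
  have hm := measurable_comp_of_dependsOn hξ (dependsOn_sum_isolatedIndicator hR ρ m)
  set p : ℝ := K * (r * Real.exp (-(r * (K + R + 1)))) with hp
  have hp0 : 0 ≤ p := by positivity
  have hp1 : p ≤ 1 := by
    rw [hp, ← prob_hasIsolated (K := K) (R := R) hξ hind hlaw 0]
    exact measureReal_le_one
  have hint : Integrable (fun ω => Real.exp (-φ * ∑ q ∈ Finset.range m,
      isolatedIndicator K R (ρ + 3 * q) fun i => ξ i ω)) P := by
    refine Integrable.of_bound (hm.const_mul (-φ)).exp.aestronglyMeasurable 1 (ae_of_all _ ?_)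
    intro ω
    rw [Real.norm_eq_abs, Real.abs_exp, Real.exp_le_one_iff, neg_mul, neg_nonpos]
    exact mul_nonneg hφ (Finset.sum_nonneg fun q _ => (isolatedIndicator_mem_Icc _ _).1)
  refine (measure_le_le_exp_mul_mgf x (neg_nonpos.mpr hφ) hint).trans ?_
  rw [mgf_sum_isolatedIndicator hξ hind hlaw hR, ← hp, neg_neg, sub_eq_add_neg (φ * x),
    Real.exp_add]
  refine mul_le_mul_of_nonneg_left ?_ (Real.exp_nonneg _)
  have hφ1 : Real.exp (-φ) ≤ 1 := Real.exp_le_one_iff.mpr (by linarith)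
  have hge : 0 ≤ 1 - p * (1 - Real.exp (-φ)) := by
    have := Real.exp_pos (-φ)
    nlinarith
  have hle : 1 - p * (1 - Real.exp (-φ)) ≤ Real.exp (-(p * (φ - φ ^ 2 / 2))) := by
    refine le_trans ?_ (Real.add_one_le_exp _)
    have := mul_le_mul_of_nonneg_left (one_sub_exp_neg_ge hφ) hp0
    linarith
  refine (pow_le_pow_left₀ hge hle m).trans ?_
  rw [← Real.exp_nat_mul, mul_neg]

theorem sum_range_three_mul (f : ℕ → ℝ) (m : ℕ) :
    ∑ b ∈ Finset.range (3 * m), f b =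
      ∑ ρ ∈ Finset.range 3, ∑ q ∈ Finset.range m, f (ρ + 3 * q) := by
  induction m with
  | zero => simp
  | succ m ih =>
    rw [show 3 * (m + 1) = 3 * m + 1 + 1 + 1 by ring, Finset.sum_range_succ, Finset.sum_range_succ,
      Finset.sum_range_succ, ih]
    simp only [Finset.sum_range_succ, Finset.sum_range_zero]
    rw [show 0 + 3 * m = 3 * m by ring, show 1 + 3 * m = 3 * m + 1 by ring,
      show 2 + 3 * m = 3 * m + 1 + 1 by ring]
    ring

/-- Lower tail of the number of groups of cells that contain an isolated cell. -/
theorem prob_sum_range_isolatedIndicator_le (hξ : ∀ i, Measurable (ξ i)) (hind : iIndepFun ξ P)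
    (hlaw : ∀ i, HasLaw (ξ i) (poissonMeasure r) P) (hR : R ≤ K) (m : ℕ) {φ : ℝ} (hφ : 0 ≤ φ)
    (x : ℝ) :
    P.real {ω | (∑ b ∈ Finset.range (3 * m), isolatedIndicator K R b fun i => ξ i ω) ≤ x} ≤
      3 * Real.exp (φ * (x / 3) -
        m * (K * (r * Real.exp (-(r * (K + R + 1)))) * (φ - φ ^ 2 / 2))) := by
  -- If the whole sum is at most `x`, one of the three residue classes contributes at most `x / 3`.
  have hsub : {ω | (∑ b ∈ Finset.range (3 * m), isolatedIndicator K R b fun i => ξ i ω) ≤ x} ⊆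
      ⋃ ρ ∈ Finset.range 3, {ω | (∑ q ∈ Finset.range m,
        isolatedIndicator K R (ρ + 3 * q) fun i => ξ i ω) ≤ x / 3} := by
    intro ω hω
    by_contra hnot
    simp only [Set.mem_iUnion, not_exists, Set.mem_ofPred_eq, not_le] at hnot hω
    rw [sum_range_three_mul] at hω
    have h0 := hnot 0 (by simp)
    have h1 := hnot 1 (by simp)
    have h2 := hnot 2 (by simp)
    simp only [Finset.sum_range_succ, Finset.sum_range_zero] at hω h0 h1 h2
    linarith
  refine (measureReal_mono hsub (measure_ne_top _ _)).trans
    ((measureReal_biUnion_finset_le _ _).trans ?_)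
  refine (Finset.sum_le_card_nsmul _ _ _ fun ρ _ =>
    prob_sum_isolatedIndicator_le hξ hind hlaw hR ρ m hφ (x / 3)).trans ?_
  simp

end Cells

/-! ### From isolated cells to laggers and loners. -/

namespace BlockTree

/-- The number of honest blocks mined during the `l`-th interval of length `w` after time `a`. -/
def cellCount (c : BlockTree) (a w : ℝ) (l : ℕ) : ℕ :=
  c.numHonest (a + l * w) (a + (l + 1 : ℕ) * w)

variable {c : BlockTree} {a w : ℝ}

theorem numHonest_eq_zero_of_cellCount (hw : 0 ≤ w) {p q : ℕ} (hpq : p ≤ q)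
    (h : ∀ l, p ≤ l → l < q → c.cellCount a w l = 0) :
    c.numHonest (a + p * w) (a + q * w) = 0 := by
  induction q, hpq using Nat.le_induction with
  | base => simp [numHonest]
  | succ q hpq ih =>
    have h1 : a + p * w ≤ a + q * w := by gcongr
    have h2 : a + q * w ≤ a + (q + 1 : ℕ) * w := by gcongr; omega
    rw [← c.numHonest_add h1 h2, ih fun l hl hl' => h l hl (by omega)]
    exact (zero_add _).trans (h q hpq (by omega))

theorem notMem_of_numHonest_eq_zero {s t : ℝ} (h : c.numHonest s t = 0) {k : ℕ}
    (hk : k ∈ c.honest) : c.mined k ∉ Set.Ioc s t := by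
  rw [numHonest, Set.ncard_eq_zero (c.finite_mined_mem_Ioc _ _ _)] at h
  intro hm
  exact (Set.eq_empty_iff_forall_notMem.mp h k) ⟨hk, hm⟩

theorem exists_isLagger_of_isolated {Δ : ℝ} {K R i : ℕ} (hw : 0 ≤ w) (hK : K * w = Δ) (hi : K ≤ i)
    (h : Isolated K R (c.cellCount a w) i) :
    ∃ k, c.IsLagger Δ k ∧ c.mined k ∈ Set.Ioc (a + i * w) (a + (i + 1 : ℕ) * w) ∧
      ∀ l ∈ c.honest, c.mined l ∈ Set.Ioc (a + i * w) (a + (i + 1 : ℕ) * w) → l = k := by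
  obtain ⟨k, hk⟩ := Set.ncard_eq_one.mp h.1
  have hmem : ∀ l, l ∈ c.honest ∧
      c.mined l ∈ Set.Ioc (a + i * w) (a + (i + 1 : ℕ) * w) ↔ l = k := fun l =>
    Set.ext_iff.mp hk l
  obtain ⟨hk1, hk2⟩ := (hmem k).mpr rfl
  refine ⟨k, ⟨hk1, fun l hl hlm => ?_⟩, hk2, fun l hl hlm => (hmem l).mp ⟨hl, hlm⟩⟩
  have hbefore := numHonest_eq_zero_of_cellCount (c := c) (a := a) hw (Nat.sub_le i K)
    (fun l hl hl' => h.2 l (by rw [Finset.mem_Icc]; omega) (by omega))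
  have hnot := notMem_of_numHonest_eq_zero hbefore hl
  rw [Nat.cast_sub hi] at hnot
  refine (hmem l).mp ⟨hl, ?_, hlm.2.trans hk2.2⟩
  by_contra hle
  refine hnot ⟨?_, not_lt.mp hle⟩
  have := hlm.1
  have := hk2.1
  linarith

theorem exists_isLoner_of_isolated {Δ : ℝ} {K i : ℕ} (hw : 0 ≤ w) (hK : K * w = Δ) (hi : K ≤ i)
    (h : Isolated K K (c.cellCount a w) i) :
    ∃ k, c.IsLoner Δ k ∧ c.mined k ∈ Set.Ioc (a + i * w) (a + (i + 1 : ℕ) * w) := by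
  obtain ⟨k, hk, hkm, huniq⟩ := exists_isLagger_of_isolated hw hK hi h
  refine ⟨k, ⟨hk, fun l hl hlm => ?_⟩, hkm⟩
  have hafter := numHonest_eq_zero_of_cellCount (c := c) (a := a) (p := i + 1) (q := i + K + 1) hw
    (by omega) (fun l hl hl' => h.2 l (by rw [Finset.mem_Icc]; omega) (by omega))
  have hnot := notMem_of_numHonest_eq_zero hafter hl
  refine huniq l hl ⟨hkm.1.trans_le hlm.1, ?_⟩
  by_contra hle
  refine hnot ⟨not_le.mp hle, ?_⟩
  have := hlm.2
  have := hkm.2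
  push_cast at this ⊢
  linarith

/-- If every isolated cell contains a block with property `p`, then the number of such blocks is
at least the number of groups of cells that contain an isolated cell. -/
theorem sum_isolatedIndicator_le {Δ t : ℝ} {K R N : ℕ} (hw : 0 ≤ w) (hK : K * w = Δ) {p : ℕ → Prop}
    (hp : ∀ i, K ≤ i → Isolated K R (c.cellCount a w) i →
      ∃ k, p k ∧ c.mined k ∈ Set.Ioc (a + i * w) (a + (i + 1 : ℕ) * w))
    (ht : a + (N + 2) * Δ ≤ t) :
    ∑ b ∈ Finset.range N, isolatedIndicator K R b (c.cellCount a w) ≤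
      ({k | p k ∧ c.mined k ∈ Set.Ioc a t}.ncard : ℝ) := by
  classical
  have hΔ : 0 ≤ Δ := by rw [← hK]; positivity
  have hsum : ∑ b ∈ Finset.range N, isolatedIndicator K R b (c.cellCount a w) =
      (((Finset.range N).filter fun b => HasIsolated K R b (c.cellCount a w)).card : ℝ) := by
    rw [Finset.card_filter]
    push_cast
    refine Finset.sum_congr rfl fun b _ => ?_
    by_cases h : HasIsolated K R b (c.cellCount a w) <;> simp [isolatedIndicator, h]
  rw [hsum]
  -- A group spans a time interval of length `Δ`; these intervals are disjoint, so different groups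
  -- yield different blocks.
  have hex : ∀ b, HasIsolated K R b (c.cellCount a w) →
      ∃ k, p k ∧ c.mined k ∈ Set.Ioc (a + (b + 1) * Δ) (a + (b + 2) * Δ) := by
    rintro b ⟨i, hi, hiso⟩
    rw [Finset.mem_Ico] at hi
    have hKi : K ≤ i := by nlinarith
    obtain ⟨k, hk, hkm⟩ := hp i hKi hiso
    refine ⟨k, hk, lt_of_le_of_lt ?_ hkm.1, hkm.2.trans ?_⟩
    · have h1 : (((b + 1) * K : ℕ) : ℝ) ≤ i := by exact_mod_cast hi.1
      have h2 := mul_le_mul_of_nonneg_right h1 hw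
      push_cast at h2
      rw [← hK]
      linarith
    · have h1 : ((i + 1 : ℕ) : ℝ) ≤ ((b + 2) * K : ℕ) := by exact_mod_cast hi.2
      have h2 := mul_le_mul_of_nonneg_right h1 hw
      push_cast at h2 ⊢
      rw [← hK]
      linarith
  choose! f hf using hex
  rw [← Set.ncard_coe_finset]
  refine Nat.cast_le.mpr (Set.ncard_le_ncard_of_injOn f ?_ ?_ (c.finite_mined_mem_Ioc _ _ _))
  · intro b hb
    simp only [Finset.coe_filter, Finset.mem_range, Set.mem_ofPred_eq] at hb
    obtain ⟨h1, h2, h3⟩ := hf b hb.2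
    refine ⟨h1, lt_of_le_of_lt ?_ h2, h3.trans (le_trans ?_ ht)⟩
    · have : 0 ≤ ((b : ℝ) + 1) * Δ := by positivity
      linarith
    · have : (b : ℝ) ≤ N := by exact_mod_cast hb.1.le
      gcongr
  · intro b hb b' hb' heq
    simp only [Finset.coe_filter, Finset.mem_range, Set.mem_ofPred_eq] at hb hb'
    obtain ⟨-, h2, h3⟩ := hf b hb.2
    obtain ⟨-, h2', h3'⟩ := hf b' hb'.2
    rw [← heq] at h2' h3'
    by_contra hne
    rcases lt_or_gt_of_ne hne with h | h
    · have : (b : ℝ) + 1 ≤ b' := by exact_mod_cast h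
      have := mul_le_mul_of_nonneg_right this hΔ
      linarith
    · have : (b' : ℝ) + 1 ≤ b := by exact_mod_cast h
      have := mul_le_mul_of_nonneg_right this hΔ
      linarith

end BlockTree

variable {Ω : Type*} [MeasurableSpace Ω]

/-! ### Lower tails of the lagger and loner counts. -/

namespace Model

variable {P : Measure Ω} {m : ℕ} {α β Δ : ℝ} (M : Model P m α β Δ)

theorem iIndepFun_cellCount (j : Fin (m + 1)) {a w : ℝ} (ha : 0 ≤ a) (hw : 0 ≤ w) :
    iIndepFun (fun l ω => (M.tree j ω).cellCount a w l) P := by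
  have hmono : Monotone fun l : ℕ => (a + l * w).toNNReal := fun l l' h =>
    Real.toNNReal_mono (by gcongr)
  convert! (M.honest_poisson j).indep_increments.nat hmono using 2 with l
  funext ω
  have h0 : ∀ l : ℕ, 0 ≤ a + l * w := fun l => by positivity
  rw [Real.coe_toNNReal _ (h0 l), Real.coe_toNNReal _ (h0 (l + 1)), BlockTree.cellCount,
    BlockTree.numHonest_eq_sub _ (h0 l)]
  gcongr
  omega

variable [IsProbabilityMeasure P]

/-- Lower tail of the number of blocks with a property that the blocks in isolated cells have. -/
theorem prob_ncard_le_of_isolated (j : Fin (m + 1)) (hα : 0 ≤ α) (hΔ : 0 < Δ) (κ : ℕ) (hκ : κ ≤ 1)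
    {p : BlockTree → ℕ → Prop}
    (hp : ∀ (c : BlockTree) (a w : ℝ) (K i : ℕ), 0 ≤ w → K * w = Δ → K ≤ i →
      Isolated K (κ * K) (c.cellCount a w) i →
      ∃ k, p c k ∧ c.mined k ∈ Set.Ioc (a + i * w) (a + (i + 1 : ℕ) * w))
    {a t φ : ℝ} (ha : 0 ≤ a) (hat : 2 * Δ ≤ t - a) (hφ : 0 ≤ φ) (hφ2 : φ ≤ 2) (x : ℝ) :
    P.real {ω | ({k | p (M.tree j ω) k ∧ (M.tree j ω).mined k ∈ Set.Ioc a t}.ncard : ℝ) ≤ x} ≤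
      3 * Real.exp ((φ * x -
        (φ - φ ^ 2 / 2) * (discount α Δ ^ (κ + 1) * α) * (t - a - 5 * Δ)) / 3) := by
  -- There are `3N` groups, and the two boundary groups cost `2Δ`. Rounding to a multiple of `3Δ`
  -- costs at most `3Δ`, whence the `5Δ` in the bound.
  set N : ℕ := ⌊(t - a - 2 * Δ) / (3 * Δ)⌋₊ with hN
  have hN1 : (N : ℝ) * (3 * Δ) ≤ t - a - 2 * Δ := by
    rw [← le_div_iff₀ (by positivity)]
    exact Nat.floor_le (div_nonneg (by linarith) (by positivity))
  have hN2 : t - a - 2 * Δ < (N + 1) * (3 * Δ) := by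
    rw [← div_lt_iff₀ (by positivity)]
    exact Nat.lt_floor_add_one _
  have hbound : ∀ n : ℕ,
      P.real {ω | ({k | p (M.tree j ω) k ∧ (M.tree j ω).mined k ∈ Set.Ioc a t}.ncard : ℝ) ≤ x} ≤
      3 * Real.exp (φ * (x / 3) - N * (α * Δ *
        Real.exp (-(α * Δ * ((κ + 1 : ℕ) + 1 / ((n : ℝ) + 1)))) * (φ - φ ^ 2 / 2))) := by
    intro n
    set K : ℕ := n + 1 with hKdef
    have hK0 : (0 : ℝ) < K := by positivity
    have hw : 0 ≤ Δ / K := by positivity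
    have hKw : K * (Δ / K) = Δ := by field_simp
    have hlaw : ∀ l, HasLaw (fun ω => (M.tree j ω).cellCount a (Δ / K) l)
        (poissonMeasure (α.toNNReal * (Δ / K).toNNReal)) P := by
      intro l
      have := M.hasLaw_numHonest j (s := a + l * (Δ / K)) (t := a + (l + 1 : ℕ) * (Δ / K))
        (by positivity) (by gcongr; omega)
      convert! this using 4
      push_cast
      ring
    -- `κ = 0` asks for no empty cells afterwards (laggers), `κ = 1` for a further time `Δ` of them
    -- (loners).
    have h := prob_sum_range_isolatedIndicator_le (R := κ * K)
      (fun l => M.measurable_numHonest j _ _) (M.iIndepFun_cellCount j ha hw) hlaw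
      ((Nat.mul_le_mul_right K hκ).trans (one_mul K).le) N hφ x
    refine (measureReal_mono (fun ω hω => ?_) (measure_ne_top _ _)).trans (h.trans_eq ?_)
    · refine le_trans (BlockTree.sum_isolatedIndicator_le (N := 3 * N) hw hKw
        (fun i hi => hp _ a _ K i hw hKw hi) ?_) hω
      push_cast
      linarith
    · rw [NNReal.coe_mul, Real.coe_toNNReal _ hα, Real.coe_toNNReal _ hw]
      congr 3
      have e1 : (K : ℝ) * (α * (Δ / K) * Real.exp (-(α * (Δ / K) * (K + (κ * K : ℕ) + 1)))) =
          α * Δ * Real.exp (-(α * Δ * ((κ + 1 : ℕ) + 1 / ((n : ℝ) + 1)))) := by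
        have e2 : α * (Δ / K) * (K + (κ * K : ℕ) + 1) =
            α * Δ * ((κ + 1 : ℕ) + 1 / ((n : ℝ) + 1)) := by
          rw [show ((n : ℝ) + 1) = K by rw [hKdef]; push_cast; ring]
          push_cast
          field_simp
          ring
        rw [e2]
        field_simp
      rw [e1]
  -- The left side does not involve the cell width, so letting it tend to zero removes the
  -- discretization error `1 / (n + 1)`.
  have hlim : Tendsto (fun n : ℕ => 3 * Real.exp (φ * (x / 3) - N * (α * Δ *
        Real.exp (-(α * Δ * ((κ + 1 : ℕ) + 1 / ((n : ℝ) + 1)))) * (φ - φ ^ 2 / 2)))) atTop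
      (nhds (3 * Real.exp (φ * (x / 3) - N * (α * Δ *
        Real.exp (-(α * Δ * ((κ + 1 : ℕ) + 0))) * (φ - φ ^ 2 / 2))))) := by
    have hcont : Continuous fun ε : ℝ => 3 * Real.exp (φ * (x / 3) - N * (α * Δ *
        Real.exp (-(α * Δ * ((κ + 1 : ℕ) + ε))) * (φ - φ ^ 2 / 2))) := by fun_prop
    exact (hcont.tendsto 0).comp tendsto_one_div_add_atTop_nhds_zero_nat
  refine (ge_of_tendsto' hlim hbound).trans ?_
  have e : Real.exp (-(α * Δ * ((κ + 1 : ℕ) + 0))) = discount α Δ ^ (κ + 1) := by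
    rw [discount, ← Real.exp_nat_mul]
    congr 1
    ring
  rw [e]
  refine mul_le_mul_of_nonneg_left (Real.exp_le_exp.mpr ?_) (by norm_num)
  have hψ : 0 ≤ (φ - φ ^ 2 / 2) * (discount α Δ ^ (κ + 1) * α) :=
    mul_nonneg (by nlinarith) (mul_nonneg (pow_pos discount_pos _).le hα)
  have := mul_le_mul_of_nonneg_left (show t - a - 5 * Δ ≤ 3 * (N * Δ) by linarith) hψ
  linarith

/-- Lower tail of the number of laggers. -/
theorem prob_numLagger_le (j : Fin (m + 1)) (hα : 0 ≤ α) (hΔ : 0 < Δ) {a t φ : ℝ} (ha : 0 ≤ a)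
    (hat : 2 * Δ ≤ t - a) (hφ : 0 ≤ φ) (hφ2 : φ ≤ 2) (x : ℝ) :
    P.real {ω | ((M.tree j ω).numLagger Δ a t : ℝ) ≤ x} ≤
      3 * Real.exp ((φ * x -
        (φ - φ ^ 2 / 2) * (discount α Δ * α) * (t - a - 5 * Δ)) / 3) := by
  have h := M.prob_ncard_le_of_isolated j hα hΔ 0 zero_le_one (p := fun c k => c.IsLagger Δ k)
    (fun c a w K i hw hK hi hiso => by
      obtain ⟨k, h1, h2, -⟩ := BlockTree.exists_isLagger_of_isolated hw hK hi hiso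
      exact ⟨k, h1, h2⟩) ha hat hφ hφ2 x
  rwa [zero_add, pow_one] at h

/-- Lower tail of the number of loners. -/
theorem prob_numLoner_le (j : Fin (m + 1)) (hα : 0 ≤ α) (hΔ : 0 < Δ) {a t φ : ℝ} (ha : 0 ≤ a)
    (hat : 2 * Δ ≤ t - a) (hφ : 0 ≤ φ) (hφ2 : φ ≤ 2) (x : ℝ) :
    P.real {ω | ((M.tree j ω).numLoner Δ a t : ℝ) ≤ x} ≤
      3 * Real.exp ((φ * x -
        (φ - φ ^ 2 / 2) * (discount α Δ ^ 2 * α) * (t - a - 5 * Δ)) / 3) :=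
  M.prob_ncard_le_of_isolated j hα hΔ 1 le_rfl (p := fun c k => c.IsLoner Δ k)
    (fun c a w K i hw hK hi hiso => by
      rw [one_mul] at hiso
      exact BlockTree.exists_isLoner_of_isolated hw hK hi hiso) ha hat hφ hφ2 x

end Model

/-! ### Numerical bounds on the Chernoff exponents. -/

section Exponents

variable {A B α β Δ δ ℓ : ℝ}

/-- Chernoff parameter `δ`: the main term is `-δ²Aℓ/2`, and the rounding of the endpoints and the
loss `5Δ` are small against `ℓδ`. The `1/9` becomes `1/27` after the division by 3 in the lagger and
loner tails. -/
theorem lower_exponent_le (hA : 0 ≤ A) (hδ : 0 < δ) (hΔ : 0 < Δ) (h : 78 * (1 + Δ) ≤ ℓ * δ) :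
    δ * ((1 - δ) * (ℓ + 1) * A) - (δ - δ ^ 2 / 2) * A * (ℓ - 1 - 5 * Δ) ≤
      -(1 / 9 * (δ ^ 2 * A * ℓ)) := by
  have h1 := mul_pos hδ hΔ
  have h2 : (1 - δ) * (ℓ + 1) - (1 - δ / 2) * (ℓ - 1 - 5 * Δ) + 1 / 9 * (ℓ * δ) ≤ 0 := by
    linarith
  have := mul_nonpos_of_nonneg_of_nonpos (mul_nonneg hA hδ.le) h2
  linarith

/-- Chernoff parameter `δ / 2`. The allowed excess is proportional to `A` rather than to the rate
`B`, so the decay does not degenerate for small `B`. -/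
theorem upper_exponent_le (hB : 0 ≤ B) (hBA : B ≤ A) (hδ : 0 < δ) (hδ1 : δ ≤ 1)
    (hΔ : 0 < Δ) (h : 78 * (1 + Δ) ≤ ℓ * δ) :
    B * (ℓ + 1) * (δ / 2 + (δ / 2) ^ 2) - δ / 2 * ((ℓ - 1) * B + (ℓ - 1) * A * δ) ≤
      -(1 / 27 * (δ ^ 2 * A * ℓ)) := by
  have h1 : B * (2 + δ / 2 * (ℓ + 1)) ≤ A * (2 + δ / 2 * (ℓ + 1)) :=
    mul_le_mul_of_nonneg_right hBA (by linarith)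
  have h2 : (2 + δ / 2 * (ℓ + 1)) - (ℓ - 1) * δ + 2 / 27 * (ℓ * δ) ≤ 0 := by linarith
  have h3 := mul_nonpos_of_nonneg_of_nonpos (hB.trans hBA) h2
  have h4 : B * (2 + δ / 2 * (ℓ + 1)) - (ℓ - 1) * A * δ + 2 / 27 * (δ * A * ℓ) ≤ 0 := by linarith
  have := mul_nonpos_of_nonneg_of_nonpos hδ.le h4
  linarith

theorem growth_exponent_le {T : ℝ} (hA : 0 ≤ A) (hδ : 0 < δ) (hT : 0 ≤ T) (hΔ : 0 < Δ)
    (h : 80 * Δ ≤ T * δ) :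
    (δ * ((1 - 41 / 40 * δ) * A * T) - (δ - δ ^ 2 / 2) * A * (T - 7 * Δ)) / 3 ≤
      -(1 / 24 * (δ ^ 2 * A * T)) := by
  have h1 := mul_pos hδ hΔ
  have h0 := mul_nonneg hT hδ.le
  have h2 : (1 - 41 / 40 * δ) * T - (1 - δ / 2) * (T - 7 * Δ) + 1 / 8 * (T * δ) ≤ 0 := by
    linarith
  have := mul_nonpos_of_nonneg_of_nonpos (mul_nonneg hA hδ.le) h2
  linarith

end Exponents

/-! ### Probability of the typical events. -/

variable {α β Δ δ : ℝ}

theorem eta_pos (hα : 0 < α) (hδ : 0 < δ) : 0 < eta α Δ δ :=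
  mul_pos (mul_pos (pow_pos hδ 2) (pow_pos discount_pos 2)) hα

/-- The union, over the intervals `(a, b]` with `⌊a⌋ = i` and `⌊b⌋ = k`, of the complements of the
good events is contained in this event. -/
def BadCell (α β Δ δ : ℝ) (i k : ℕ) (c : BlockTree) : Prop :=
  (c.numHonest (i + 1) k : ℝ) ≤ (1 - δ) * ((k - i : ℝ) + 1) * α ∨
  (1 + δ) * ((k - i : ℝ) - 1) * α ≤ c.numHonest i (k + 1) ∨
  (c.numLagger Δ (i + 1) k : ℝ) ≤ (1 - δ) * ((k - i : ℝ) + 1) * (discount α Δ * α) ∨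
  (c.numLoner Δ (i + 1) k : ℝ) ≤ (1 - δ) * ((k - i : ℝ) + 1) * (discount α Δ ^ 2 * α) ∨
  ((k - i : ℝ) - 1) * β + ((k - i : ℝ) - 1) * (discount α Δ ^ 2 * α) * δ ≤
    c.numAdversarial i (k + 1)

/-- Counts are monotone in the interval: lower bounds are tested on the inner integer interval,
upper bounds on the outer one, while `b - a` differs from `k - i` by at most 1. -/
theorem badCell_of_not_goodEvent (hα : 0 < α) (hβ : 0 ≤ β) (hδ : 0 < δ) (hδ1 : δ ≤ 1) {a b : ℝ}
    {i k : ℕ} (hia : i ≤ a) (hai : a ≤ i + 1) (hkb : k ≤ b) (hbk : b ≤ k + 1) {c : BlockTree}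
    (h : ¬ GoodEvent α β Δ δ a b c) : BadCell α β Δ δ i k c := by
  unfold GoodEvent at h
  have hg := discount_pos (α := α) (Δ := Δ)
  have hmul : ∀ r : ℝ, 0 ≤ r → (1 - δ) * (b - a) * r ≤ (1 - δ) * ((k - i : ℝ) + 1) * r :=
    fun r hr => mul_le_mul_of_nonneg_right
      (mul_le_mul_of_nonneg_left (by linarith) (by linarith)) hr
  have hmul' : ∀ r : ℝ, 0 ≤ r → ((k - i : ℝ) - 1) * r ≤ (b - a) * r := fun r hr =>
    mul_le_mul_of_nonneg_right (by linarith) hr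
  simp only [not_and_or, not_lt] at h
  rcases h with (h | h) | h | h | h
  · left
    have h1 : (c.numHonest (i + 1) k : ℝ) ≤ c.numHonest a b := by
      exact_mod_cast c.numHonest_mono hai hkb
    linarith [hmul α hα.le]
  · right; left
    have h1 : (c.numHonest a b : ℝ) ≤ c.numHonest i (k + 1) := by
      exact_mod_cast c.numHonest_mono hia hbk
    linarith [hmul' ((1 + δ) * α) (by positivity)]
  · right; right; left
    have h1 : (c.numLagger Δ (i + 1) k : ℝ) ≤ c.numLagger Δ a b := by
      exact_mod_cast c.numLagger_mono Δ hai hkb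
    linarith [hmul (discount α Δ * α) (by positivity)]
  · right; right; right; left
    have h1 : (c.numLoner Δ (i + 1) k : ℝ) ≤ c.numLoner Δ a b := by
      exact_mod_cast c.numLoner_mono Δ hai hkb
    linarith [hmul (discount α Δ ^ 2 * α) (by positivity)]
  · right; right; right; right
    have h1 : (c.numAdversarial a b : ℝ) ≤ c.numAdversarial i (k + 1) := by
      exact_mod_cast c.numAdversarial_mono hia hbk
    linarith [hmul' β hβ, hmul' (discount α Δ ^ 2 * α * δ) (by positivity)]

variable {Ω : Type*} [MeasurableSpace Ω]

namespace Model

variable {P : Measure Ω} [IsProbabilityMeasure P] {m : ℕ} (M : Model P m α β Δ)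

theorem prob_badCell_le (j : Fin (m + 1)) (hα : 0 < α) (hβ : 0 ≤ β) (hΔ : 0 < Δ) (hδ : 0 < δ)
    (hδ1 : δ ≤ 1) (hβ' : β ≤ discount α Δ ^ 2 * α) {i k : ℕ}
    (hik : 78 * (1 + Δ) ≤ ((k : ℝ) - i) * δ) :
    P.real {ω | BadCell α β Δ δ i k (M.tree j ω)} ≤
      9 * Real.exp (-(1 / 27 * eta α Δ δ * ((k : ℝ) - i))) := by
  have hg := discount_pos (α := α) (Δ := Δ)
  have hg1 := discount_lt_one hα hΔ
  have hg2 := discount_sq_le hα hΔ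
  have hℓ : 78 * (1 + Δ) ≤ (k : ℝ) - i := by
    by_contra hlt
    rcases le_or_gt ((k : ℝ) - i) 0 with h0 | h0
    · have := mul_nonpos_of_nonpos_of_nonneg h0 hδ.le
      linarith
    · have := mul_le_mul_of_nonneg_left hδ1 h0.le
      linarith
  set A := discount α Δ ^ 2 * α with hA
  have hA0 : 0 < A := by positivity
  have hAg : A ≤ discount α Δ * α := mul_le_mul_of_nonneg_right hg2 hα.le
  have hgα : discount α Δ * α ≤ α := by
    have := mul_le_mul_of_nonneg_right hg1.le hα.le
    linarith
  have hη : eta α Δ δ = δ ^ 2 * A := by rw [eta, hA]; ring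
  rw [hη]
  have hmono : ∀ r, A ≤ r → δ ^ 2 * A * ((k : ℝ) - i) ≤ δ ^ 2 * r * ((k : ℝ) - i) := fun r hr =>
    mul_le_mul_of_nonneg_right (mul_le_mul_of_nonneg_left hr (by positivity)) (by linarith)
  have hpos : 0 ≤ δ ^ 2 * A * ((k : ℝ) - i) := mul_nonneg (by positivity) (by linarith)
  have hi0 : (0 : ℝ) ≤ i := Nat.cast_nonneg i
  have b1 : P.real {ω | ((M.tree j ω).numHonest (i + 1) k : ℝ) ≤
      (1 - δ) * ((k - i : ℝ) + 1) * α} ≤ Real.exp (-(1 / 27 * (δ ^ 2 * A) * ((k : ℝ) - i))) := by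
    refine (M.prob_numHonest_le_le j hα.le (by linarith) (by linarith) hδ.le _).trans
      (Real.exp_le_exp.mpr ?_)
    have h1 := lower_exponent_le hα.le hδ hΔ hik
    have h2 := hmono α (hAg.trans hgα)
    have h3 : 0 ≤ (δ - δ ^ 2 / 2) * α * (5 * Δ) :=
      mul_nonneg (mul_nonneg (by nlinarith) hα.le) (by linarith)
    linarith
  have b2 : P.real {ω | (1 + δ) * ((k - i : ℝ) - 1) * α ≤ (M.tree j ω).numHonest i (k + 1)} ≤
      Real.exp (-(1 / 27 * (δ ^ 2 * A) * ((k : ℝ) - i))) := by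
    refine (M.prob_numHonest_ge_le j hα.le hi0 (by linarith) (θ := δ / 2) (by linarith)
      (by linarith) _).trans (Real.exp_le_exp.mpr ?_)
    have h1 := upper_exponent_le hα.le le_rfl hδ hδ1 hΔ hik
    have h2 := hmono α (hAg.trans hgα)
    linarith
  have b3 : P.real {ω | ((M.tree j ω).numLagger Δ (i + 1) k : ℝ) ≤
      (1 - δ) * ((k - i : ℝ) + 1) * (discount α Δ * α)} ≤
      3 * Real.exp (-(1 / 27 * (δ ^ 2 * A) * ((k : ℝ) - i))) := by
    refine (M.prob_numLagger_le j hα.le hΔ (by linarith) (by linarith) hδ.le (by linarith) _).trans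
      (mul_le_mul_of_nonneg_left (Real.exp_le_exp.mpr ?_) (by norm_num))
    have h1 := lower_exponent_le (by positivity : 0 ≤ discount α Δ * α) hδ hΔ hik
    have h2 := hmono (discount α Δ * α) hAg
    linarith
  have b4 : P.real {ω | ((M.tree j ω).numLoner Δ (i + 1) k : ℝ) ≤
      (1 - δ) * ((k - i : ℝ) + 1) * A} ≤
      3 * Real.exp (-(1 / 27 * (δ ^ 2 * A) * ((k : ℝ) - i))) := by
    refine (M.prob_numLoner_le j hα.le hΔ (by linarith) (by linarith) hδ.le (by linarith) _).trans
      (mul_le_mul_of_nonneg_left (Real.exp_le_exp.mpr ?_) (by norm_num))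
    have h1 := lower_exponent_le hA0.le hδ hΔ hik
    rw [← hA]
    linarith
  have b5 : P.real {ω | ((k - i : ℝ) - 1) * β + ((k - i : ℝ) - 1) * A * δ ≤
      (M.tree j ω).numAdversarial i (k + 1)} ≤
      Real.exp (-(1 / 27 * (δ ^ 2 * A) * ((k : ℝ) - i))) := by
    have hx : 0 < ((k - i : ℝ) - 1) * β + ((k - i : ℝ) - 1) * A * δ :=
      add_pos_of_nonneg_of_pos (mul_nonneg (by linarith) hβ)
        (mul_pos (mul_pos (by linarith) hA0) hδ)
    refine (M.prob_numAdversarial_ge_le j hβ hi0 (by linarith) (θ := δ / 2) (by linarith)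
      (by linarith) hx).trans (Real.exp_le_exp.mpr ?_)
    have h1 := upper_exponent_le hβ hβ' hδ hδ1 hΔ hik
    linarith
  simp only [BadCell, Set.ofPred_or]
  have u := fun s t : Set Ω => measureReal_union_le (μ := P) s t
  refine (u _ _).trans ?_
  -- The constant is `9 = 1 + 1 + 3 + 3 + 1`.
  refine (add_le_add b1 ((u _ _).trans (add_le_add b2 ((u _ _).trans (add_le_add b3
    ((u _ _).trans (add_le_add b4 b5))))))).trans_eq ?_
  ring

/-- The typical events are likely. -/
theorem prob_not_typicalEvent_le (j : Fin (m + 1)) (hα : 0 < α) (hβ : 0 ≤ β) (hΔ : 0 < Δ)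
    (hδ : 0 < δ) (hδ1 : δ ≤ 1) (hβ' : β ≤ discount α Δ ^ 2 * α) {s t : ℝ} (hs : 0 ≤ s)
    (hst : 78 * (1 + Δ) ≤ (t - s - 1) * δ) :
    P {ω | ¬ TypicalEvent α β Δ δ s t (M.tree j ω)} ≤
      ENNReal.ofReal (mu α Δ δ * Real.exp (-(eta α Δ δ / 27 * (t - s)))) := by
  have hη := eta_pos (Δ := Δ) hα hδ
  set η := eta α Δ δ with hηdef
  set q := Real.exp (-(1 / 27 * η)) with hq
  have hq0 : 0 < q := Real.exp_pos _
  have hq1 : q < 1 := Real.exp_lt_one_iff.mpr (by linarith)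
  have hts : 0 ≤ t - s - 1 := by
    by_contra hlt
    have := mul_neg_of_neg_of_pos (not_le.mp hlt) hδ
    linarith
  have hs1 := Nat.floor_le hs
  have ht0 : 0 ≤ t := by linarith
  have ht1 := Nat.lt_floor_add_one t
  set C := 9 * Real.exp (-(1 / 27 * η * ((⌊t⌋₊ : ℝ) - ⌊s⌋₊))) with hC
  have hC0 : 0 ≤ C := by positivity
  -- `u` and `v` are the distances by which the rounded endpoints move outwards; each unit costs a
  -- factor `q`. The condition on `u` guards against truncated subtraction.
  let S : ℕ → ℕ → Set Ω := fun u v =>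
    {ω | u ≤ ⌊s⌋₊ ∧ BadCell α β Δ δ (⌊s⌋₊ - u) (⌊t⌋₊ + v) (M.tree j ω)}
  have hsub : {ω | ¬ TypicalEvent α β Δ δ s t (M.tree j ω)} ⊆ ⋃ u, ⋃ v, S u v := by
    intro ω hω
    simp only [Set.mem_ofPred_eq, TypicalEvent, not_forall] at hω
    obtain ⟨a, ⟨ha0, has⟩, b, hb, hbad⟩ := hω
    have h1 : ⌊a⌋₊ ≤ ⌊s⌋₊ := Nat.floor_le_floor has
    have h2 : ⌊t⌋₊ ≤ ⌊b⌋₊ := Nat.floor_le_floor hb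
    refine Set.mem_iUnion₂.mpr ⟨⌊s⌋₊ - ⌊a⌋₊, ⌊b⌋₊ - ⌊t⌋₊, Nat.sub_le _ _, ?_⟩
    rw [Nat.sub_sub_self h1, Nat.add_sub_cancel' h2]
    exact badCell_of_not_goodEvent hα hβ hδ hδ1 (Nat.floor_le ha0) (Nat.lt_floor_add_one a).le
      (Nat.floor_le (ht0.trans hb)) (Nat.lt_floor_add_one b).le hbad
  have hS : ∀ u v, P (S u v) ≤ ENNReal.ofReal C * (ENNReal.ofReal q ^ u * ENNReal.ofReal q ^ v) := by
    intro u v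
    by_cases hu : u ≤ ⌊s⌋₊
    · have e1 : (((⌊t⌋₊ + v : ℕ) : ℝ) - (⌊s⌋₊ - u : ℕ)) = (⌊t⌋₊ - ⌊s⌋₊) + u + v := by
        rw [Nat.cast_sub hu]; push_cast; ring
      have h1 : 78 * (1 + Δ) ≤ (((⌊t⌋₊ + v : ℕ) : ℝ) - (⌊s⌋₊ - u : ℕ)) * δ := by
        refine hst.trans (mul_le_mul_of_nonneg_right ?_ hδ.le)
        rw [e1]
        have := Nat.cast_nonneg (α := ℝ) u
        have := Nat.cast_nonneg (α := ℝ) v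
        linarith
      have h2 := M.prob_badCell_le j hα hβ hΔ hδ hδ1 hβ' h1
      have e2 : 9 * Real.exp (-(1 / 27 * eta α Δ δ *
          (((⌊t⌋₊ + v : ℕ) : ℝ) - (⌊s⌋₊ - u : ℕ)))) = C * (q ^ u * q ^ v) := by
        rw [e1, hC, hq, ← Real.exp_nat_mul, ← Real.exp_nat_mul, mul_assoc (9 : ℝ),
          ← Real.exp_add, ← Real.exp_add, ← hηdef]
        congr 2
        ring
      rw [e2] at h2
      rw [← ENNReal.ofReal_pow hq0.le, ← ENNReal.ofReal_pow hq0.le,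
        ← ENNReal.ofReal_mul (by positivity), ← ENNReal.ofReal_mul hC0]
      refine (measure_mono (t := {ω | BadCell α β Δ δ (⌊s⌋₊ - u) (⌊t⌋₊ + v) (M.tree j ω)})
        fun ω hω => hω.2).trans ?_
      rw [← ofReal_measureReal]
      exact ENNReal.ofReal_le_ofReal h2
    · have : S u v = ∅ := Set.eq_empty_of_forall_notMem fun ω hω => hu hω.1
      rw [this, measure_empty]
      exact zero_le
  calc P {ω | ¬ TypicalEvent α β Δ δ s t (M.tree j ω)}
      ≤ ∑' u, ∑' v, ENNReal.ofReal C * (ENNReal.ofReal q ^ u * ENNReal.ofReal q ^ v) :=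
        (measure_mono hsub).trans <| (measure_iUnion_le _).trans <| ENNReal.tsum_le_tsum fun u =>
          (measure_iUnion_le _).trans <| ENNReal.tsum_le_tsum fun v => hS u v
    _ = ENNReal.ofReal (C / (1 - q) ^ 2) := by
        simp_rw [ENNReal.tsum_mul_left, ENNReal.tsum_mul_right, ENNReal.tsum_geometric]
        rw [← ENNReal.ofReal_one, ← ENNReal.ofReal_sub _ hq0.le,
          ← ENNReal.ofReal_inv_of_pos (by linarith), ← ENNReal.ofReal_mul (by
            rw [inv_nonneg]; linarith), ← ENNReal.ofReal_mul hC0]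
        congr 1
        rw [div_eq_mul_inv, pow_two, mul_inv]
    _ ≤ ENNReal.ofReal (mu α Δ δ * Real.exp (-(η / 27 * (t - s)))) := by
        refine ENNReal.ofReal_le_ofReal ?_
        rw [mu, ← hηdef, ← hq, div_mul_eq_mul_div, mul_assoc, ← Real.exp_add]
        refine div_le_div_of_nonneg_right ?_ (by positivity)
        refine mul_le_mul_of_nonneg_left (Real.exp_le_exp.mpr ?_) (by norm_num)
        -- The allowance of 2 for rounding is the factor `e^{2η/27}` in `mu`; the denominator came
        -- from the double geometric series.
        have := mul_le_mul_of_nonneg_left (show t - s - 2 ≤ (⌊t⌋₊ : ℝ) - ⌊s⌋₊ by linarith)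
          (show 0 ≤ 1 / 27 * η by positivity)
        linarith

end Model

/-! ### Probability of growth, and the main theorem. -/

theorem BlockTree.honestAmongLast_add_adversarialAmongLast {c : BlockTree} {k d : ℕ}
    (h : k ≤ c.height d) : c.honestAmongLast k d + c.adversarialAmongLast k d = k := by
  classical
  have h1 := List.length_eq_countP_add_countP (fun x => decide (x ∈ c.honest))
    (l := c.lastBlocks k d)
  have h2 : (c.lastBlocks k d).length = k := by
    simp only [lastBlocks, List.rtake, List.length_drop, length_chain]
    omega
  rw [h2] at h1
  simp only [decide_not, honestAmongLast, adversarialAmongLast]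
  convert! h1.symm using 2
  simp

namespace Model

variable {Ω : Type*} [MeasurableSpace Ω] {P : Measure Ω} [IsProbabilityMeasure P] {m : ℕ}
  {α β Δ δ : ℝ} (M : Model P m α β Δ)

/-- Blockchain growth with high probability. -/
theorem prob_growth_le (j : Fin (m + 1)) (hα : 0 < α) (hΔ : 0 < Δ) (hδ : 0 < δ) (hδ1 : δ ≤ 1)
    {s t : ℝ} (hs : 0 ≤ s) (hst : 80 * Δ / δ ≤ t - s) :
    P {ω | ∃ d e, (M.tree j ω).Credible Δ t d ∧ (M.tree j ω).Credible Δ s e ∧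
        ((M.tree j ω).height d : ℝ) <
          (M.tree j ω).height e + (1 - 41 / 40 * δ) * discount α Δ * α * (t - s)}
      ≤ ENNReal.ofReal (9 * Real.exp (-(1 / 24 * eta α Δ δ * (t - s)))) := by
  have hst' : 80 * Δ ≤ (t - s) * δ := by rwa [div_le_iff₀ hδ] at hst
  have hT : 0 ≤ t - s := by
    by_contra hlt
    have := mul_neg_of_neg_of_pos (not_le.mp hlt) hδ
    linarith
  have hT2 : 80 * Δ ≤ t - s := by
    have := mul_le_mul_of_nonneg_left hδ1 hT
    linarith
  -- Growth can fail only through a shortage of laggers, so this one tail suffices in place of the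
  -- whole good event.
  have h := M.prob_numLagger_le j hα.le hΔ (a := s + Δ) (t := t - Δ) (by linarith) (by linarith)
    hδ.le (by linarith) ((1 - 41 / 40 * δ) * (discount α Δ * α) * (t - s))
  refine (measure_mono (t := {ω | ((M.tree j ω).numLagger Δ (s + Δ) (t - Δ) : ℝ) ≤
    (1 - 41 / 40 * δ) * (discount α Δ * α) * (t - s)}) ?_).trans ?_
  · rintro ω ⟨d, e, hd, he, hlt⟩
    have h1 := BlockTree.height_add_numLagger_le hΔ hs (by linarith) (M.follows j ω) hd he.1
    have h2 : ((M.tree j ω).height e : ℝ) + (M.tree j ω).numLagger Δ (s + Δ) (t - Δ) ≤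
      (M.tree j ω).height d := by exact_mod_cast h1
    rw [Set.mem_ofPred_eq]
    linarith
  · rw [← ofReal_measureReal]
    refine ENNReal.ofReal_le_ofReal (h.trans ?_)
    have hA : 0 ≤ discount α Δ * α := mul_nonneg discount_pos.le hα.le
    have h1 := growth_exponent_le hA hδ hT hΔ hst'
    have h2 : δ ^ 2 * (discount α Δ ^ 2 * α) * (t - s) ≤ δ ^ 2 * (discount α Δ * α) * (t - s) :=
      mul_le_mul_of_nonneg_right (mul_le_mul_of_nonneg_left
        (mul_le_mul_of_nonneg_right (discount_sq_le hα hΔ) hα.le) (sq_nonneg δ)) hT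
    refine mul_le_mul (by norm_num) (Real.exp_le_exp.mpr ?_) (Real.exp_nonneg _) (by norm_num)
    rw [eta]
    linarith

end Model

theorem window_bounds {α Δ δ t : ℝ} {k : ℕ} (hα : 0 < α) (hΔ : 0 < Δ) (hδ : 0 < δ)
    (hδ' : δ < 40 / 81) (hk : 160 * α * (1 + Δ) / δ ≤ k)
    (hkt : k / ((1 - 41 / 40 * δ) * discount α Δ * α) ≤ t) :
    0 < k ∧ 80 * (1 + Δ) / δ ≤ k / (2 * α) ∧ k / (2 * α) ≤ t := by
  have hk0 : (0 : ℝ) < k := lt_of_lt_of_le (by positivity) hk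
  have hg := discount_pos (α := α) (Δ := Δ)
  have hc : 0 < 1 - 41 / 40 * δ := by linarith
  refine ⟨by exact_mod_cast hk0, ?_, le_trans ?_ hkt⟩
  · rw [le_div_iff₀ (by positivity)]
    refine le_trans (le_of_eq ?_) hk
    ring
  · refine div_le_div_of_nonneg_left hk0.le (mul_pos (mul_pos hc hg) hα) ?_
    have h1 : (1 - 41 / 40 * δ) * discount α Δ ≤ 1 :=
      mul_le_one₀ (by linarith) hg.le (discount_lt_one hα hΔ).le
    have := mul_le_mul_of_nonneg_right h1 hα.le
    linarith

end Prism

end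

/-- The blockchain growth, blockchain quality and common prefix theorems for the Prism backbone
protocol. An upper bound on the (outer) measure of a failure event says that the complementary
event has at least the complementary probability. -/
theorem mainTheorem9 {Ω : Type*} [MeasurableSpace Ω] (P : Measure Ω) [IsProbabilityMeasure P]
    (m : ℕ) (α β Δ δ : ℝ) (hα : 1 / 2 < α) (hβ : 0 ≤ β) (hΔ : 0 < Δ)
    (hδ : 0 < δ) (hδ' : δ < 40 / 81)
    (hαβ : β < (1 - 81 / 40 * δ) * Prism.discount α Δ ^ 2 * α)
    (M : Prism.Model P m α β Δ) :
    -- blockchain growth, for all categories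
    (∀ j : Fin (m + 1), ∀ s t : ℝ, 0 ≤ s → s < t - 80 * Δ / δ →
      (∀ ω, Prism.GoodEvent α β Δ δ (s + Δ) (t - Δ) (M.tree j ω) →
        ∀ d e, (M.tree j ω).Credible Δ t d → (M.tree j ω).Credible Δ s e →
          ((M.tree j ω).height e : ℝ) + (1 - 41 / 40 * δ) * Prism.discount α Δ * α * (t - s)
            ≤ (M.tree j ω).height d) ∧
      P {ω | ∃ d e, (M.tree j ω).Credible Δ t d ∧ (M.tree j ω).Credible Δ s e ∧
          ((M.tree j ω).height d : ℝ) <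
            (M.tree j ω).height e + (1 - 41 / 40 * δ) * Prism.discount α Δ * α * (t - s)}
        ≤ ENNReal.ofReal (9 * Real.exp (-(1 / 24 * Prism.eta α Δ δ * (t - s))))) ∧
    -- blockchain quality, for all categories
    (∀ j : Fin (m + 1), ∀ (k : ℕ) (t : ℝ), 160 * α * (1 + Δ) / δ ≤ k →
      k / ((1 - 41 / 40 * δ) * Prism.discount α Δ * α) ≤ t →
      (∀ ω, Prism.TypicalEvent α β Δ δ (t - k / (2 * α) + Δ) (t - Δ) (M.tree j ω) →
        ∀ d, (M.tree j ω).Credible Δ t d →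
          k ≤ (M.tree j ω).height d ∧
          (1 - Prism.discount α Δ) * k ≤ (M.tree j ω).honestAmongLast k d) ∧
      P {ω | ∃ d, (M.tree j ω).Credible Δ t d ∧
          Prism.discount α Δ * k < (M.tree j ω).adversarialAmongLast k d}
        ≤ ENNReal.ofReal (Prism.mu α Δ δ *
            Real.exp (-(Prism.eta α Δ δ / 27 * (k / (2 * α) - 2 * Δ))))) ∧
    -- common prefix, for the voter categories
    (∀ j : Fin (m + 1), j ≠ 0 → ∀ (k : ℕ) (t : ℝ), 160 * α * (1 + Δ) / δ ≤ k →
      k / ((1 - 41 / 40 * δ) * Prism.discount α Δ * α) ≤ t →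
      (∀ ω, Prism.TypicalEvent α β Δ δ (t - k / (2 * α) + Δ) (t - Δ) (M.tree j ω) →
        ∀ d, (M.tree j ω).Credible Δ t d →
          k - 1 ≤ (M.tree j ω).height d ∧
          ∀ r, t ≤ r → ∀ e, (M.tree j ω).Credible Δ r e →
            (M.tree j ω).deepPrefix (k - 1) d <+: (M.tree j ω).chain e) ∧
      P {ω | ¬ ∀ d, (M.tree j ω).Credible Δ t d →
          k - 1 ≤ (M.tree j ω).height d ∧
          (M.tree j ω).PermanentAfter Δ t ((M.tree j ω).deepPrefix (k - 1) d)}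
        ≤ ENNReal.ofReal (Prism.mu α Δ δ *
            Real.exp (-(Prism.eta α Δ δ / 27 * (k / (2 * α) - 2 * Δ))))) := by
  have hα0 : 0 < α := by linarith
  have hδ1 : δ ≤ 1 := by linarith
  have hβ' : β ≤ Prism.discount α Δ ^ 2 * α := by
    have : 0 ≤ δ * (Prism.discount α Δ ^ 2 * α) :=
      mul_nonneg hδ.le (mul_nonneg (sq_nonneg _) hα0.le)
    linarith
  have typical : ∀ (j : Fin (m + 1)) (k : ℕ) (t : ℝ), 160 * α * (1 + Δ) / δ ≤ k →
      k / ((1 - 41 / 40 * δ) * Prism.discount α Δ * α) ≤ t →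
      P {ω | ¬ Prism.TypicalEvent α β Δ δ (t - k / (2 * α) + Δ) (t - Δ) (M.tree j ω)} ≤
        ENNReal.ofReal (Prism.mu α Δ δ *
            Real.exp (-(Prism.eta α Δ δ / 27 * (k / (2 * α) - 2 * Δ)))) := by
    intro j k t hk hkt
    obtain ⟨-, hτ, hτt⟩ := Prism.window_bounds hα0 hΔ hδ hδ' hk hkt
    -- Of `80 (1 + Δ)`, the trimming by `2Δ` and the rounding by 1 use at most `2 (1 + Δ)`, which
    -- leaves the required 78.
    have h := M.prob_not_typicalEvent_le j hα0 hβ hΔ hδ hδ1 hβ'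
      (s := t - k / (2 * α) + Δ) (t := t - Δ) (by linarith) (by
        rw [div_le_iff₀ hδ] at hτ
        have := mul_le_mul_of_nonneg_left hδ1 (show 0 ≤ 2 * Δ + 1 by linarith)
        linarith)
    rwa [show t - Δ - (t - k / (2 * α) + Δ) = k / (2 * α) - 2 * Δ by ring] at h
  have hdiv : ∀ τ : ℝ, 80 * (1 + Δ) / δ ≤ τ → 80 * Δ / δ ≤ τ := fun τ h =>
    le_trans (div_le_div_of_nonneg_right (by linarith) hδ.le) h
  have quality : ∀ (j : Fin (m + 1)) (k : ℕ) (t : ℝ), 160 * α * (1 + Δ) / δ ≤ k →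
      k / ((1 - 41 / 40 * δ) * Prism.discount α Δ * α) ≤ t → ∀ ω,
      Prism.TypicalEvent α β Δ δ (t - k / (2 * α) + Δ) (t - Δ) (M.tree j ω) →
        ∀ d, (M.tree j ω).Credible Δ t d →
          k ≤ (M.tree j ω).height d ∧
          (1 - Prism.discount α Δ) * k ≤ (M.tree j ω).honestAmongLast k d := by
    intro j k t hk hkt ω hG d hd
    obtain ⟨hk0, hτ, hτt⟩ := Prism.window_bounds hα0 hΔ hδ hδ' hk hkt
    have hh := hG.le_height hα0 hΔ (hdiv _ hτ) hδ hτt hδ' hkt (M.follows j ω) hd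
    exact ⟨hh, hG.quality hα0 hΔ rfl (hdiv _ hτ) hk0 hδ hτt hαβ hδ' (M.follows j ω) hd hh⟩
  have common : ∀ (j : Fin (m + 1)) (k : ℕ) (t : ℝ), 160 * α * (1 + Δ) / δ ≤ k →
      k / ((1 - 41 / 40 * δ) * Prism.discount α Δ * α) ≤ t → ∀ ω,
      Prism.TypicalEvent α β Δ δ (t - k / (2 * α) + Δ) (t - Δ) (M.tree j ω) →
        ∀ d, (M.tree j ω).Credible Δ t d →
          k - 1 ≤ (M.tree j ω).height d ∧
          (M.tree j ω).PermanentAfter Δ t ((M.tree j ω).deepPrefix (k - 1) d) := by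
    intro j k t hk hkt ω hG d hd
    obtain ⟨hk0, hτ, hτt⟩ := Prism.window_bounds hα0 hΔ hδ hδ' hk hkt
    have hh := (Nat.sub_le k 1).trans (quality j k t hk hkt ω hG d hd).1
    exact ⟨hh, hG.deepPrefix_prefix hα0 hΔ rfl hτ hk0 hδ hτt (by positivity) hαβ hδ'
      (M.follows j ω) hd hh⟩
  refine ⟨fun j s t hs hst => ⟨fun ω hG d e hd he => ?_, ?_⟩,
    fun j k t hk hkt => ⟨quality j k t hk hkt, ?_⟩,
    fun j _ k t hk hkt => ⟨common j k t hk hkt, ?_⟩⟩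
  · exact hG.height_add_le hα0 hδ hδ1 hΔ (M.follows j ω) hs (by linarith) hd he.1
  · exact M.prob_growth_le j hα0 hΔ hδ hδ1 hs (by linarith)
  · refine (measure_mono ?_).trans (typical j k t hk hkt)
    rintro ω ⟨d, hd, hlt⟩ hG
    obtain ⟨h1, h2⟩ := quality j k t hk hkt ω hG d hd
    have h3 := Prism.BlockTree.honestAmongLast_add_adversarialAmongLast h1
    have h4 : ((M.tree j ω).honestAmongLast k d : ℝ) + (M.tree j ω).adversarialAmongLast k d = k := by
      exact_mod_cast h3
    linarith
  · refine (measure_mono ?_).trans (typical j k t hk hkt)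
    intro ω hω hG
    exact hω (common j k t hk hkt ω hG)
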